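/- Let $\mathfrak g$ be a real nilpotent Lie algebra of finite even dimension, with descending central series $\mathfrak g^0=\mathfrak g$, $\mathfrak g^i=[\mathfrak g^{i-1},\mathfrak g]$, and nilindex $m$ (the least integer with $\mathfrak g^m=0$). Suppose that $\mathfrak g$ is quasi-filiform, i.e. $m=\dim\mathfrak g-2$, and of the form $t_r$ for an integer $r$ with $3\le r\le m$, i.e. for $1\le i\le m$ the quotient $\mathfrak g^{i-1}/\mathfrak g^{i}$ has dimension $2$ if $i\in\{1,r\}$ and dimension $1$ otherwise. Let $V_i\subset\mathfrak g^*$ be the annihilator of $\mathfrak g^i$; the nilpotency degree $\mathrm{nil}(\theta)$ of a complex $1$-form $\theta\in\mathfrak g^*\otimes\mathbb C$ is the least $i$ with $\theta\in V_i\otimes\mathbb C$. Let $\mathcal J$ be a generalized complex structure on $\mathfrak g$: a linear endomorphism of $\mathfrak g\oplus\mathfrak g^*$ with $\mathcal J^2=-\mathrm{Id}$, orthogonal for $\langle X+\xi,Y+\eta\rangle=\frac12(\xi(Y)+\eta(X))$, whose $+i$-eigenspace $L\subset(\mathfrak g\oplus\mathfrak g^*)\otimes\mathbb C$ is closed under the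 ($\mathbb C$-bilinear) Courant bracket $[X+\xi,Y+\eta]_c=[X,Y]+\mathcal L_X\eta-\mathcal L_Y\xi-\frac12 d(i_X\eta-i_Y\xi)$. Let $k$ be its type, i.e. the codimension of the projection of $L$ in $\mathfrak g\otimes\mathbb C$. Complex $1$-forms $\theta_1,\dots,\theta_k$ are said to be associated with $\mathcal J$ if there are real $2$-forms $B,\omega$ on $\mathfrak g$ such that the spinor $\rho=\theta_1\wedge\dots\wedge\theta_k\wedge e^{B+i\omega}$ satisfies $L=\{X+\xi : i_X\rho+\xi\wedge\rho=0\}$. They are called appropriate if $\mathrm{nil}(\theta_i)\le\mathrm{nil}(\theta_j)$ for $i<j$ and, for every $i$, the forms $\theta_j$ with $\mathrm{nil}(\theta_j)>i$ are linearly independent modulo $V_i\otimes\mathbb C$. Then there are appropriate forms $\theta_1,\dots,\theta_k$ associated with $\mathcal J$ whose nilpotency degrees $(\mathrm{nil}(\theta_1),\dots,\mathrm{nil}(\theta_k))$ are the first $k$ terms of one of the two sequences $$(1,\ r,\ r+1,\ r+2,\ \dots),\qquad (1,\ r,\ r,\ r+1,\ r+2,\ \dots),$$ that is, $(1,r,r+1,\dots,r+k-2)$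 or $(1,r,r,r+1,\dots,r+k-3)$. Moreover, if some forms $\theta_1,\dots,\theta_k$ associated with $\mathcal J$ have the nilpotency degrees of the second sequence, then $k<r$. -/

import Mathlib

open scoped TensorProduct

noncomputable section

namespace GenComplex

/-! ### Nilpotent Lie algebras: nilindex, the graded pieces, quasi-filiform algebras -/

section Nilpotent

variable (g : Type*) [LieRing g] [LieAlgebra ℝ g]

/-- The descending central series `g⁰ = g`, `gⁱ = [gⁱ⁻¹, g]`, as real subspaces of `g`. -/
def centralSeries (i : ℕ) : Submodule ℝ g :=
  (LieModule.lowerCentralSeries ℝ g g i).toSubmodule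

/-- The nilindex of `g`: the least `m` such that `gᵐ = 0`. -/
def nilindex : ℕ := sInf {m : ℕ | centralSeries g m = ⊥}

/-- The dimension of `gⁱ / gⁱ⁺¹`, the piece `W_{i+1}` of the associated graded algebra. -/
def gradedDim (i : ℕ) : ℕ :=
  Module.finrank ℝ
    (centralSeries g i ⧸ (centralSeries g (i + 1)).submoduleOf (centralSeries g i))

/-- A nilpotent Lie algebra is quasi-filiform if its nilindex is `dim g - 2`. -/
def IsQuasiFiliform : Prop :=
  LieRing.IsNilpotent g ∧ nilindex g + 2 = Module.finrank ℝ g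

/-- `g` is of the form `{p 1, …, p m}`, where `m` is its nilindex: `dim W_i = p i`. -/
def IsOfForm (p : ℕ → ℕ) : Prop :=
  ∀ i : ℕ, i < nilindex g → gradedDim g i = p (i + 1)

/-- `g` is of the form `t_r` with `2 ≤ r ≤ m`: the spaces `W_1` and `W_r` have dimension `2`,
the other ones have dimension `1`. -/
def IsOfFormT (r : ℕ) : Prop :=
  2 ≤ r ∧ r ≤ nilindex g ∧ IsOfForm g (fun i => if i = 1 ∨ i = r then 2 else 1)

end Nilpotent

/-! ### The space `h ⊕ h*` of a Lie algebra `h` -/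

section Double

variable (R h : Type*) [CommRing R] [LieRing h] [LieAlgebra R h]

/-- The space `h ⊕ h*`. -/
abbrev Double : Type _ := h × Module.Dual R h

variable {R h}

/-- The Lie derivative of a 1-form, `(𝓛_X η)(Y) = dη(X, Y) = -η([X, Y])`. -/
def lieDeriv (X : h) (η : Module.Dual R h) : Module.Dual R h :=
  -(η ∘ₗ (LieAlgebra.ad R h X))

/-- The Courant bracket
`[X + ξ, Y + η]_c = [X, Y] + 𝓛_X η - 𝓛_Y ξ - ½ d(i_X η - i_Y ξ)`; its last term is zero, because
`i_X η - i_Y ξ` is a constant (a form of degree `0`). -/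
def courant (u v : Double R h) : Double R h :=
  (⁅u.1, v.1⁆, lieDeriv u.1 v.2 - lieDeriv v.1 u.2)

/-- The Clifford action `(X + ξ) ∘ ρ = i_X ρ + ξ ∧ ρ` of `h ⊕ h*` on the forms `⋀ h*`, as a linear
map in `X + ξ` for a given form `ρ`. -/
def clifford (ρ : ExteriorAlgebra R (Module.Dual R h)) :
    Double R h →ₗ[R] ExteriorAlgebra R (Module.Dual R h) :=
  (CliffordAlgebra.contractLeft.flip ρ ∘ₗ Module.Dual.eval R h) ∘ₗ LinearMap.fst R _ _ +
    (LinearMap.mulRight R ρ ∘ₗ ExteriorAlgebra.ι R) ∘ₗ LinearMap.snd R _ _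

/-- `L_ρ = {X + ξ | (X + ξ) ∘ ρ = 0}`. -/
def spinorAnnihilator (ρ : ExteriorAlgebra R (Module.Dual R h)) : Submodule R (Double R h) :=
  LinearMap.ker (clifford ρ)

end Double

section Complex

variable {g : Type*} [LieRing g] [LieAlgebra ℝ g]

/-- The scalar product `⟨X + ξ, Y + η⟩ = ½ (ξ(Y) + η(X))` on `g ⊕ g*`. -/
def pairing (u v : Double ℝ g) : ℝ := (1 / 2) * (u.2 v.1 + v.2 u.1)

/-! ### Complexification -/

variable (g) in
/-- The complexification of `g`, a complex Lie algebra. -/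
abbrev Cx : Type _ := ℂ ⊗[ℝ] g

variable (g) in
/-- The complex 1-forms on `g`, i.e. the `ℂ`-linear forms on the complexification. -/
abbrev CxForm : Type _ := Module.Dual ℂ (Cx g)

variable (g) in
/-- The inclusion of the real 1-forms into the complex 1-forms, by `ℂ`-linear extension. -/
def formToCx : Module.Dual ℝ g →ₗ[ℝ] CxForm g := Module.Dual.baseChange ℂ

variable (g) in
/-- The inclusion `X + ξ ↦ 1 ⊗ X + ξ_ℂ` of `g ⊕ g*` into the double of the complexification. -/
def doubleToCx : Double ℝ g →ₗ[ℝ] Double ℂ (Cx g) :=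
  ((TensorProduct.mk ℝ ℂ g 1) ∘ₗ LinearMap.fst ℝ _ _).prod
    (formToCx g ∘ₗ LinearMap.snd ℝ _ _)

variable (g) in
/-- The inclusion of the real forms (of all degrees) into the complex forms. -/
def formsToCx :
    ExteriorAlgebra ℝ (Module.Dual ℝ g) →ₐ[ℝ] ExteriorAlgebra ℂ (CxForm g) :=
  ExteriorAlgebra.lift ℝ
    ⟨((ExteriorAlgebra.ι ℂ (M := CxForm g)).restrictScalars ℝ) ∘ₗ formToCx g,
      fun _ => ExteriorAlgebra.ι_sq_zero _⟩

/-! ### Generalized complex structures -/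

/-- The `+i`-eigenspace of an endomorphism of `g ⊕ g*`, inside the complexification of
`g ⊕ g*`, which is identified with the double of the complexification of `g`. -/
def eigenL (J : Double ℝ g →ₗ[ℝ] Double ℝ g) : Submodule ℂ (Double ℂ (Cx g)) :=
  (Module.End.eigenspace (J.baseChange ℂ) Complex.I).map
    (LinearMap.liftBaseChange ℂ (doubleToCx g))

variable (g) in
/-- A generalized complex structure on `g`. -/
structure GeneralizedComplexStructure where
  /-- The endomorphism of `g ⊕ g*`. -/
  J : Double ℝ g →ₗ[ℝ] Double ℝ g
  sq_eq : ∀ u, J (J u) = -u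
  orthogonal : ∀ u v, pairing (J u) (J v) = pairing u v
  involutive : ∀ u ∈ eigenL J, ∀ v ∈ eigenL J, courant u v ∈ eigenL J

namespace GeneralizedComplexStructure

/-- The `+i`-eigenspace `L`. -/
def L (𝒥 : GeneralizedComplexStructure g) : Submodule ℂ (Double ℂ (Cx g)) := eigenL 𝒥.J

/-- The type: the (complex) codimension of the projection of `L` to the complexification
of `g`. -/
def type (𝒥 : GeneralizedComplexStructure g) : ℕ :=
  Module.finrank ℂ (Cx g ⧸ 𝒥.L.map (LinearMap.fst ℂ (Cx g) (CxForm g)))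

/-- The complex 1-forms `θ₁, …, θ_k` are associated with the generalized complex structure:
for some real 2-forms `B` and `ω`, its `+i`-eigenspace is `L_ρ` for the spinor
`ρ = θ₁ ∧ ⋯ ∧ θ_k ∧ exp (B + i ω)` (2-forms are nilpotent in the exterior algebra). -/
def IsAssociated (𝒥 : GeneralizedComplexStructure g) {k : ℕ} (θ : Fin k → CxForm g) : Prop :=
  ∃ B ∈ ⋀[ℝ]^2 (Module.Dual ℝ g), ∃ ω ∈ ⋀[ℝ]^2 (Module.Dual ℝ g),
    spinorAnnihilator (ExteriorAlgebra.ιMulti ℂ k θ *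
      IsNilpotent.exp (formsToCx g B + Complex.I • formsToCx g ω)) = 𝒥.L

end GeneralizedComplexStructure

/-! ### Nilpotency degrees -/

variable (g) in
/-- The complexification of `V_i`, the space of the 1-forms on `g` that vanish on `gⁱ`. -/
def V (i : ℕ) : Submodule ℂ (CxForm g) :=
  Submodule.span ℂ (formToCx g '' (centralSeries g i).dualAnnihilator)

/-- The nilpotency degree of a complex 1-form: the least `i` such that it belongs to `V_i`. -/
def nilDegree (θ : CxForm g) : ℕ := sInf {i : ℕ | θ ∈ V g i}

/-- The conditions on a decomposition `Ω = θ₁ ∧ ⋯ ∧ θ_k` to be appropriate: the nilpotency degrees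
are non-decreasing, and for all `i` the `θ_j` with `nil θ_j > i` are linearly independent
modulo `V_i`. -/
def IsAppropriate {k : ℕ} (θ : Fin k → CxForm g) : Prop :=
  (∀ i j, i < j → nilDegree (θ i) ≤ nilDegree (θ j)) ∧
  ∀ i : ℕ, LinearIndependent ℂ
    (fun j : {j : Fin k // i < nilDegree (θ j)} => (V g i).mkQ (θ j.1))

/-- The sequence `1, r, r + 1, r + 2, …`; its first `k` terms end in `r + k - 2` if `2 ≤ k`. -/
def firstDegrees (r : ℕ) : ℕ → ℕ
  | 0 => 1
  | i + 1 => r + i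

/-- The sequence `1, r, r, r + 1, …`; its first `k` terms end in `r + k - 3` if `3 ≤ k`. -/
def secondDegrees (r : ℕ) : ℕ → ℕ
  | 0 => 1
  | 1 => r
  | i + 2 => r + i

end Complex

end GenComplex

end

/-! Write `E` for the projection of `L` to `g_ℂ`. Pure linear algebra shows that the bases of the
annihilator `Ann E` are families of forms associated with `𝒥`. Conversely, forms associated with `𝒥`
lie in `Ann E`, and are independent when `g ≠ 0`. Hence only two properties of `E` matter: it is a
subalgebra, because `L` is Courant-closed, and `E + conj E = g_ℂ`, because `L + conj L` is
everything.

Filter `Ann E` by `F_i = Ann E ∩ V_i = Ann (E + gⁱ)` and put `d_i = dim F_i`. Four facts bound these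
dimensions. Reality: `E + gⁱ` and its conjugate span `g_ℂ` and both contain `gⁱ`, so `2 d_i + dim gⁱ
≤ dim g` (`two_mul_finrank_le`); in form `t_r` with `3 ≤ r` this gives `d_2 ≤ 1`. Size: `d_{i+1} -
d_i` is at most `dim gⁱ/gⁱ⁺¹`, thus `2` at the jumps to `1` and `r`, and `1` otherwise
(`finrank_sup_add_le`). Propagation: if `d` does not jump at one step, it does not jump at the next,
provided the next graded piece is a line (`cxSeries_succ_le_sup`). Generation: `d_1 = 0` forces `E =
g_ℂ`, so the type is `0` (`eq_top_of_sup_cxSeries_one`).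

So when the type is positive, `d` is `1` from index `1` to `r - 1`. At `r` it may jump by `0`, `1`
or `2`; afterwards it grows by one at a time until it stops for good. A jump of `2` gives the second
sequence, the others the first (`degrees_of_dimensions`). A basis adapted to the filtration is then
appropriate with these degrees. The final bound is reality again: with the second sequence and `k ≥
3` all forms lie in `F_{r+k-3}`, so `2k ≤ r + k - 1`. -/

noncomputable section

namespace GenComplex

/-! ### Two-forms in the exterior algebra: centrality, nilpotency, contraction -/

section TwoForms

variable {R M : Type*} [CommRing R] [AddCommGroup M] [Module R M]

open ExteriorAlgebra CliffordAlgebra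

lemma two_form_induction {p : ExteriorAlgebra R M → Prop}
    (mul : ∀ a b : M, p (ExteriorAlgebra.ι R a * ExteriorAlgebra.ι R b))
    (add : ∀ x y, x ∈ ⋀[R]^2 M → y ∈ ⋀[R]^2 M → p x → p y → p (x + y))
    {y : ExteriorAlgebra R M} (hy : y ∈ ⋀[R]^2 M) : p y := by
  suffices y ∈ ⋀[R]^2 M ∧ p y from this.2
  have hy' := hy
  rw [exteriorPower, pow_two] at hy'
  refine Submodule.mul_induction_on hy' ?_ ?_
  · rintro _ ⟨a, rfl⟩ _ ⟨b, rfl⟩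
    refine ⟨?_, mul a b⟩
    rw [exteriorPower, pow_two]
    exact Submodule.mul_mem_mul ⟨a, rfl⟩ ⟨b, rfl⟩
  · exact fun x y hx hy => ⟨add_mem hx.1 hy.1, add x y hx.1 hy.1 hx.2 hy.2⟩

lemma ι_mul_ι_mem_two_forms (a b : M) :
    ExteriorAlgebra.ι R a * ExteriorAlgebra.ι R b ∈ ⋀[R]^2 M := by
  rw [exteriorPower, pow_two]
  exact Submodule.mul_mem_mul ⟨a, rfl⟩ ⟨b, rfl⟩

lemma ι_mul_ι_comm (a b : M) : ExteriorAlgebra.ι R a * ExteriorAlgebra.ι R b =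
    -(ExteriorAlgebra.ι R b * ExteriorAlgebra.ι R a) :=
  eq_neg_of_add_eq_zero_left (ExteriorAlgebra.ι_add_mul_swap a b)

/-- Moving a vector past a product of two vectors changes the sign twice. -/
lemma commute_two_form {y : ExteriorAlgebra R M} (hy : y ∈ ⋀[R]^2 M) (x : ExteriorAlgebra R M) :
    Commute y x := by
  refine two_form_induction (p := fun y => Commute y x) (fun a b => ?_)
    (fun _ _ _ _ h₁ h₂ => h₁.add_left h₂) hy
  induction x using ExteriorAlgebra.induction with
  | algebraMap r => exact (Algebra.commutes r _).symm
  | ι c =>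
    change _ * _ = _ * _
    rw [mul_assoc, ι_mul_ι_comm b c, mul_neg, ← mul_assoc, ι_mul_ι_comm a c, neg_mul, neg_neg,
      mul_assoc]
  | mul x y hx hy => exact hx.mul_right hy
  | add x y hx hy => exact hx.add_right hy

lemma isNilpotent_two_form {y : ExteriorAlgebra R M} (hy : y ∈ ⋀[R]^2 M) : IsNilpotent y := by
  refine two_form_induction (p := IsNilpotent) (fun a b => ⟨2, ?_⟩)
    (fun x y hx _ h₁ h₂ => (commute_two_form hx y).isNilpotent_add h₁ h₂) hy
  rw [pow_two, ← mul_assoc, (commute_two_form (ι_mul_ι_mem_two_forms a b) _).eq, ← mul_assoc,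
    ExteriorAlgebra.ι_sq_zero, zero_mul, zero_mul]

/-- Contraction is an antiderivation, so no sign appears when it passes an element of even degree.
-/
lemma contractLeft_two_form_mul (d : Module.Dual R M) {y : ExteriorAlgebra R M}
    (hy : y ∈ ⋀[R]^2 M) (x : ExteriorAlgebra R M) :
    contractLeft d (y * x : ExteriorAlgebra R M) =
      (contractLeft d y * x + y * contractLeft d x : ExteriorAlgebra R M) := by
  refine two_form_induction (p := fun y => contractLeft d (y * x : ExteriorAlgebra R M) =
      (contractLeft d y * x + y * contractLeft d x : ExteriorAlgebra R M)) (fun a b => ?_)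
    (fun x y _ _ h₁ h₂ => ?_) hy
  · simp only [ExteriorAlgebra.ι, mul_assoc, contractLeft_ι_mul, contractLeft_ι]
    simp only [mul_sub, sub_mul, mul_assoc, ← Algebra.commutes, Algebra.smul_def]
    rw [← mul_assoc (CliffordAlgebra.ι 0 a) (algebraMap R _ (d b)), ← Algebra.commutes, mul_assoc]
    abel
  · rw [add_mul, map_add, map_add, h₁, h₂]; noncomm_ring

lemma contractLeft_two_form_pow (d : Module.Dual R M) {y : ExteriorAlgebra R M}
    (hy : y ∈ ⋀[R]^2 M) (n : ℕ) :
    contractLeft d (y ^ (n + 1) : ExteriorAlgebra R M) =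
      ((n + 1 : ℕ) • (contractLeft d y * y ^ n) : ExteriorAlgebra R M) := by
  induction n with
  | zero => simp
  | succ n ih =>
    rw [pow_succ', contractLeft_two_form_mul d hy, ih, mul_smul_comm, ← mul_assoc,
      (commute_two_form hy (contractLeft d y)).eq, mul_assoc, ← pow_succ' y, succ_nsmul' _ (n + 1)]

lemma contractLeft_two_form_pow_mul (d : Module.Dual R M) {y : ExteriorAlgebra R M}
    (hy : y ∈ ⋀[R]^2 M) (n : ℕ) (x : ExteriorAlgebra R M) :
    contractLeft d (y ^ n * x : ExteriorAlgebra R M) =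
      (contractLeft d (y ^ n : ExteriorAlgebra R M) * x + y ^ n * contractLeft d x :
        ExteriorAlgebra R M) := by
  induction n generalizing x with
  | zero =>
    have : contractLeft d (1 : ExteriorAlgebra R M) = 0 := contractLeft_one (Q := 0) d
    simp [this]
  | succ n ih =>
    rw [pow_succ', mul_assoc, contractLeft_two_form_mul d hy, ih, contractLeft_two_form_mul d hy]
    noncomm_ring

end TwoForms

/-! ### Contraction of the exponential of a two-form -/

section Exp

variable {K M : Type*} [Field K] [AddCommGroup M] [Module K M]
  [Module ℚ (ExteriorAlgebra K M)]

open CliffordAlgebra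

lemma exp_two_form_eq_sum {y : ExteriorAlgebra K M} {N : ℕ} (hN : y ^ N = 0) :
    IsNilpotent.exp y = ∑ n ∈ Finset.range N, (n.factorial : K)⁻¹ • y ^ n := by
  rw [IsNilpotent.exp_eq_sum hN]
  exact Finset.sum_congr rfl fun n _ => inv_natCast_smul_eq ℚ K _ _

lemma commute_exp_two_form {y : ExteriorAlgebra K M} (hy : y ∈ ⋀[K]^2 M)
    (x : ExteriorAlgebra K M) : Commute (IsNilpotent.exp y) x := by
  obtain ⟨N, hN⟩ := isNilpotent_two_form hy
  rw [exp_two_form_eq_sum hN]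
  exact Commute.sum_left _ _ _ fun n _ => ((commute_two_form hy x).pow_left n).smul_left _

variable [CharZero K]

lemma contractLeft_exp (d : Module.Dual K M) {y : ExteriorAlgebra K M} (hy : y ∈ ⋀[K]^2 M) :
    contractLeft d (IsNilpotent.exp y : ExteriorAlgebra K M) =
      (contractLeft d y * IsNilpotent.exp y : ExteriorAlgebra K M) := by
  obtain ⟨N, hN⟩ := isNilpotent_two_form hy
  -- One extra, vanishing, term on the left: contraction lowers the exponent by one, so both sums
  -- then have `N` terms.
  conv_lhs => rw [exp_two_form_eq_sum (N := N + 1) (by rw [pow_succ, hN, zero_mul])]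
  rw [exp_two_form_eq_sum hN, Finset.sum_range_succ', map_add, map_sum, Finset.mul_sum]
  have h0 : contractLeft d (((0 : ℕ).factorial : K)⁻¹ • y ^ 0 : ExteriorAlgebra K M) = 0 := by
    rw [pow_zero, map_smul]
    exact (congrArg _ (contractLeft_one (Q := (0 : QuadraticForm K M)) d)).trans (smul_zero _)
  rw [h0, add_zero]
  refine Finset.sum_congr rfl fun n _ => ?_
  rw [map_smul, contractLeft_two_form_pow d hy, mul_smul_comm, ← Nat.cast_smul_eq_nsmul K,
    smul_smul, Nat.factorial_succ, Nat.cast_mul, mul_inv, mul_right_comm, inv_mul_cancel₀, one_mul]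
  exact_mod_cast n.succ_ne_zero

lemma contractLeft_exp_mul (d : Module.Dual K M) {y : ExteriorAlgebra K M} (hy : y ∈ ⋀[K]^2 M)
    (x : ExteriorAlgebra K M) :
    contractLeft d (IsNilpotent.exp y * x : ExteriorAlgebra K M) =
      (IsNilpotent.exp y * (contractLeft d y * x + contractLeft d x) : ExteriorAlgebra K M) := by
  have h : contractLeft d (IsNilpotent.exp y * x : ExteriorAlgebra K M) =
      (contractLeft d (IsNilpotent.exp y : ExteriorAlgebra K M) * x +
        IsNilpotent.exp y * contractLeft d x : ExteriorAlgebra K M) := by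
    obtain ⟨N, hN⟩ := isNilpotent_two_form hy
    simp only [exp_two_form_eq_sum hN, Finset.sum_mul, map_sum, smul_mul_assoc, map_smul,
      contractLeft_two_form_pow_mul d hy, smul_add, Finset.sum_add_distrib]
  rw [h, contractLeft_exp d hy, ← (commute_exp_two_form hy (contractLeft d y)).eq, mul_add,
    mul_assoc]

end Exp

/-! ### Clifford action and isotropy of spinor annihilators -/

section Annihilator

variable {h : Type*} [LieRing h] [LieAlgebra ℂ h]

lemma clifford_apply (ρ : ExteriorAlgebra ℂ (Module.Dual ℂ h)) (u : Double ℂ h) :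
    clifford ρ u = CliffordAlgebra.contractLeft (Module.Dual.eval ℂ h u.1) ρ +
      ExteriorAlgebra.ι ℂ u.2 * ρ := rfl

/-- The bilinear extension of (twice) the scalar product to a complex Lie algebra. -/
def cxPairing (u v : Double ℂ h) : ℂ := u.2 v.1 + v.2 u.1

/-- The Clifford relation; it makes the annihilator of a nonzero spinor isotropic. -/
lemma clifford_clifford (ρ : ExteriorAlgebra ℂ (Module.Dual ℂ h)) (u v : Double ℂ h) :
    clifford (clifford ρ v) u + clifford (clifford ρ u) v = cxPairing u v • ρ := by
  have h1 : ∀ (X : h) (ξ : Module.Dual ℂ h),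
      CliffordAlgebra.contractLeft (Module.Dual.eval ℂ h X) (ExteriorAlgebra.ι ℂ ξ * ρ) =
        ξ X • ρ - ExteriorAlgebra.ι ℂ ξ *
          CliffordAlgebra.contractLeft (Module.Dual.eval ℂ h X) ρ :=
    fun X ξ => CliffordAlgebra.contractLeft_ι_mul (Q := 0) _ ξ ρ
  have h2 : CliffordAlgebra.contractLeft (Module.Dual.eval ℂ h u.1)
        (CliffordAlgebra.contractLeft (Module.Dual.eval ℂ h v.1) ρ) =
      -CliffordAlgebra.contractLeft (Module.Dual.eval ℂ h v.1)
        (CliffordAlgebra.contractLeft (Module.Dual.eval ℂ h u.1) ρ) :=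
    CliffordAlgebra.contractLeft_comm (Q := 0) _ _ _
  simp only [clifford_apply, map_add, mul_add, h1, h2, ← mul_assoc, ι_mul_ι_comm u.2 v.2, neg_mul,
    cxPairing, add_smul]
  abel

lemma cxPairing_eq_zero_of_mem_spinorAnnihilator {ρ : ExteriorAlgebra ℂ (Module.Dual ℂ h)}
    (hρ : ρ ≠ 0) {u v : Double ℂ h} (hu : u ∈ spinorAnnihilator ρ) (hv : v ∈ spinorAnnihilator ρ) :
    cxPairing u v = 0 := by
  have := clifford_clifford ρ u v
  rw [show clifford ρ v = 0 from hv, show clifford ρ u = 0 from hu] at this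
  simpa [clifford_apply, hρ, eq_comm] using this

lemma ιMulti_ne_zero {M : Type*} [AddCommGroup M] [Module ℂ M] {k : ℕ} {θ : Fin k → M}
    (hθ : LinearIndependent ℂ θ) : ExteriorAlgebra.ιMulti ℂ k θ ≠ 0 := by
  have := (exteriorPower.ιMulti_family_linearIndependent_field (n := k) hθ).ne_zero
    (Set.powersetCard.ofFinEmbEquiv (OrderIso.refl (Fin k)).toOrderEmbedding)
  refine fun h0 => this (Subtype.ext ?_)
  rw [exteriorPower.ιMulti_family_apply_coe, ExteriorAlgebra.ιMulti_family,
    Equiv.symm_apply_apply]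
  exact h0

lemma contractLeft_ιMulti {M : Type*} [AddCommGroup M] [Module ℂ M] (d : Module.Dual ℂ M) {k : ℕ}
    (θ : Fin k → M) (hd : ∀ j, d (θ j) = 0) :
    CliffordAlgebra.contractLeft d (ExteriorAlgebra.ιMulti ℂ k θ) = 0 := by
  induction k with
  | zero => rw [ExteriorAlgebra.ιMulti_zero_apply]; exact CliffordAlgebra.contractLeft_one (Q := 0) d
  | succ k ih =>
    rw [ExteriorAlgebra.ιMulti_succ_apply]
    refine (CliffordAlgebra.contractLeft_ι_mul (Q := 0) d (θ 0) _).trans ?_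
    have := ih (Matrix.vecTail θ) (fun j => hd _)
    rw [hd, zero_smul, zero_sub, neg_eq_zero]
    exact (congrArg _ this).trans (mul_zero _)

lemma ι_mul_ιMulti {M : Type*} [AddCommGroup M] [Module ℂ M] {k : ℕ} (θ : Fin k → M) {ξ : M}
    (hξ : ξ ∈ Submodule.span ℂ (Set.range θ)) :
    ExteriorAlgebra.ι ℂ ξ * ExteriorAlgebra.ιMulti ℂ k θ = 0 := by
  induction hξ using Submodule.span_induction with
  | mem x hx =>
    obtain ⟨i, rfl⟩ := hx
    rw [ExteriorAlgebra.ιMulti_apply]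
    exact ExteriorAlgebra.ι_mul_prod_list θ i
  | zero => simp
  | add x y _ _ hx hy => rw [map_add, add_mul, hx, hy, add_zero]
  | smul a x _ hx => rw [map_smul, smul_mul_assoc, hx, smul_zero]

end Annihilator
end GenComplex
end

noncomputable section

namespace GenComplex

/-! ### The eigenspace `L` is maximal isotropic -/

section Eigenspace

variable {g : Type*} [LieRing g] [LieAlgebra ℝ g]

lemma doubleToCx_fst (a : Double ℝ g) : (doubleToCx g a).1 = 1 ⊗ₜ a.1 := rfl

lemma doubleToCx_snd_tmul (a : Double ℝ g) (z : ℂ) (x : g) :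
    (doubleToCx g a).2 (z ⊗ₜ x) = z * (a.2 x : ℂ) := by
  simp [doubleToCx, formToCx, mul_comm]

lemma formToCx_tmul (α : Module.Dual ℝ g) (z : ℂ) (x : g) :
    formToCx g α (z ⊗ₜ x) = z * (α x : ℂ) := by
  simp [formToCx, mul_comm]

lemma exists_tmul_add {M : Type*} [AddCommGroup M] [Module ℝ M] (w : ℂ ⊗[ℝ] M) :
    ∃ a b : M, w = (1 : ℂ) ⊗ₜ[ℝ] a + Complex.I • ((1 : ℂ) ⊗ₜ[ℝ] b) := by
  induction w using TensorProduct.induction_on with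
  | zero => exact ⟨0, 0, by simp⟩
  | tmul z x =>
    refine ⟨z.re • x, z.im • x, ?_⟩
    rw [← TensorProduct.smul_tmul, ← TensorProduct.smul_tmul, TensorProduct.smul_tmul',
      ← TensorProduct.add_tmul]
    congr 1
    apply Complex.ext <;> simp
  | add w₁ w₂ h₁ h₂ =>
    obtain ⟨a₁, b₁, rfl⟩ := h₁
    obtain ⟨a₂, b₂, rfl⟩ := h₂
    refine ⟨a₁ + a₂, b₁ + b₂, ?_⟩
    rw [TensorProduct.tmul_add, TensorProduct.tmul_add, smul_add]; abel

lemma exists_formToCx_add (θ : CxForm g) :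
    ∃ α β : Module.Dual ℝ g, θ = formToCx g α + Complex.I • formToCx g β ∧
      ∀ x, θ (1 ⊗ₜ x) = α x + Complex.I * β x := by
  let t : g →ₗ[ℝ] ℂ := θ.restrictScalars ℝ ∘ₗ TensorProduct.mk ℝ ℂ g 1
  refine ⟨Complex.reLm ∘ₗ t, Complex.imLm ∘ₗ t, ?_, fun x => ?_⟩
  · ext x
    simp only [LinearMap.add_apply, LinearMap.smul_apply, TensorProduct.AlgebraTensorModule.curry_apply,
      TensorProduct.curry_apply, LinearMap.coe_restrictScalars, formToCx_tmul]
    simp [t, mul_comm Complex.I, Complex.re_add_im]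
  · simp [t, mul_comm Complex.I, Complex.re_add_im]

lemma exists_doubleToCx_add (w : Double ℂ (Cx g)) :
    ∃ a b : Double ℝ g, w = doubleToCx g a + Complex.I • doubleToCx g b := by
  obtain ⟨x, y, hxy⟩ := exists_tmul_add w.1
  obtain ⟨α, β, h, -⟩ := exists_formToCx_add w.2
  exact ⟨(x, α), (y, β), Prod.ext hxy h⟩

lemma cxPairing_doubleToCx (a b : Double ℝ g) :
    cxPairing (doubleToCx g a) (doubleToCx g b) = ((2 * pairing a b : ℝ) : ℂ) := by
  rw [cxPairing, doubleToCx_fst, doubleToCx_fst, doubleToCx_snd_tmul, doubleToCx_snd_tmul, pairing]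
  push_cast; ring

lemma cxPairing_add_left {h : Type*} [LieRing h] [LieAlgebra ℂ h] (u v w : Double ℂ h) :
    cxPairing (u + v) w = cxPairing u w + cxPairing v w := by
  simp [cxPairing]; ring

lemma cxPairing_smul_left {h : Type*} [LieRing h] [LieAlgebra ℂ h] (z : ℂ) (u w : Double ℂ h) :
    cxPairing (z • u) w = z * cxPairing u w := by
  simp [cxPairing]; ring

lemma cxPairing_comm {h : Type*} [LieRing h] [LieAlgebra ℂ h] (u w : Double ℂ h) :
    cxPairing u w = cxPairing w u := by
  simp [cxPairing]; ring

lemma pairing_comm (u w : Double ℝ g) : pairing u w = pairing w u := by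
  simp [pairing]; ring

lemma eq_zero_of_cxPairing {v : Double ℂ (Cx g)} (h : ∀ u, cxPairing v u = 0) : v = 0 := by
  have h2 : v.2 = 0 := by
    refine LinearMap.ext fun x => ?_
    simpa [cxPairing] using h (x, 0)
  refine Prod.ext ?_ h2
  change v.1 = 0
  rw [← Module.forall_dual_apply_eq_zero_iff ℂ]
  intro f; simpa [cxPairing] using h (0, f)

namespace GeneralizedComplexStructure

variable (𝒥 : GeneralizedComplexStructure g)

lemma mem_L_iff (w : Double ℂ (Cx g)) :
    w ∈ 𝒥.L ↔ ∃ a, w = doubleToCx g a - Complex.I • doubleToCx g (𝒥.J a) := by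
  have hJ : ∀ a, 𝒥.J.baseChange ℂ ((1 : ℂ) ⊗ₜ[ℝ] a) = 1 ⊗ₜ 𝒥.J a := fun a => by simp
  have hI : ∀ a : ℂ ⊗[ℝ] Double ℝ g, Complex.I • Complex.I • a = -a := fun a => by
    rw [smul_smul, Complex.I_mul_I, neg_one_smul]
  rw [L, eigenL]
  constructor
  · rintro ⟨w, hw, rfl⟩
    rw [SetLike.mem_coe, Module.End.mem_eigenspace_iff] at hw
    obtain ⟨a, b, hab⟩ := exists_tmul_add w
    -- `(1 - iJ)/2` is the projector onto the `+i`-eigenspace; applied to `a + ib` it yields `c -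
    -- iJc` with `c = (a + Jb)/2`.
    have hw' : w = (1 / 2 : ℂ) • (w - Complex.I • 𝒥.J.baseChange ℂ w) := by
      rw [hw, hI, sub_neg_eq_add, ← two_smul ℂ w, smul_smul]; norm_num
    have : w = (1 : ℂ) ⊗ₜ[ℝ] ((1 / 2 : ℝ) • (a + 𝒥.J b)) -
        Complex.I • ((1 : ℂ) ⊗ₜ[ℝ] 𝒥.J ((1 / 2 : ℝ) • (a + 𝒥.J b))) := by
      conv_lhs => rw [hw', hab, map_add, map_smul, hJ, hJ, smul_add, hI]
      simp only [map_smul, map_add, 𝒥.sq_eq, TensorProduct.tmul_smul, TensorProduct.tmul_add,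
        TensorProduct.tmul_neg]
      have hr : ∀ x : ℂ ⊗[ℝ] Double ℝ g, (1 / 2 : ℝ) • x = (1 / 2 : ℂ) • x := fun x => by
        rw [← algebraMap_smul ℂ (1 / 2 : ℝ) x]; simp
      simp only [hr]
      module
    refine ⟨(1 / 2 : ℝ) • (a + 𝒥.J b), ?_⟩
    conv_lhs => rw [this]
    rw [map_sub, map_smul, LinearMap.liftBaseChange_tmul, LinearMap.liftBaseChange_tmul, one_smul,
      one_smul]
  · rintro ⟨a, rfl⟩
    refine ⟨(1 : ℂ) ⊗ₜ[ℝ] a - Complex.I • ((1 : ℂ) ⊗ₜ[ℝ] 𝒥.J a), ?_, ?_⟩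
    · rw [SetLike.mem_coe, Module.End.mem_eigenspace_iff, map_sub, map_smul, hJ, hJ, 𝒥.sq_eq,
        smul_sub, hI, TensorProduct.tmul_neg, smul_neg]
      abel
    · rw [map_sub, map_smul, LinearMap.liftBaseChange_tmul, LinearMap.liftBaseChange_tmul, one_smul,
        one_smul]

lemma pairing_J_left (a b : Double ℝ g) : pairing (𝒥.J a) b = -pairing a (𝒥.J b) := by
  rw [← 𝒥.orthogonal (𝒥.J a) b, 𝒥.sq_eq]
  simp [pairing]; ring

lemma cxPairing_eq_zero {u v : Double ℂ (Cx g)} (hu : u ∈ 𝒥.L) (hv : v ∈ 𝒥.L) :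
    cxPairing u v = 0 := by
  obtain ⟨a, rfl⟩ := (𝒥.mem_L_iff u).1 hu
  obtain ⟨b, rfl⟩ := (𝒥.mem_L_iff v).1 hv
  have hl : ∀ c d u : Double ℂ (Cx g), cxPairing (c - Complex.I • d) u =
      cxPairing c u - Complex.I * cxPairing d u := fun c d u => by
    rw [sub_eq_add_neg, ← neg_smul, cxPairing_add_left, cxPairing_smul_left]; ring
  rw [hl, cxPairing_comm, hl, cxPairing_comm (doubleToCx g (𝒥.J a)), hl]
  simp only [cxPairing_doubleToCx, 𝒥.orthogonal]
  rw [pairing_comm b, pairing_comm (𝒥.J b) a, pairing_comm b, 𝒥.pairing_J_left]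
  push_cast
  linear_combination (2 * pairing a b : ℂ) * Complex.I_mul_I

/-- The conjugate of `L` is isotropic. -/
lemma cxPairing_conj_eq_zero (a b : Double ℝ g) :
    cxPairing (doubleToCx g a + Complex.I • doubleToCx g (𝒥.J a))
      (doubleToCx g b + Complex.I • doubleToCx g (𝒥.J b)) = 0 := by
  have hl : ∀ c d u : Double ℂ (Cx g), cxPairing (c + Complex.I • d) u =
      cxPairing c u + Complex.I * cxPairing d u := fun c d u => by
    rw [cxPairing_add_left, cxPairing_smul_left]
  rw [hl, cxPairing_comm, hl, cxPairing_comm (doubleToCx g (𝒥.J a)), hl]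
  simp only [cxPairing_doubleToCx, 𝒥.orthogonal]
  rw [pairing_comm b, pairing_comm (𝒥.J b) a, pairing_comm b, 𝒥.pairing_J_left]
  push_cast
  linear_combination (2 * pairing a b : ℂ) * Complex.I_mul_I

lemma exists_add_conj (w : Double ℂ (Cx g)) : ∃ u ∈ 𝒥.L, ∃ c,
    w = u + (doubleToCx g c + Complex.I • doubleToCx g (𝒥.J c)) := by
  obtain ⟨a, b, rfl⟩ := exists_doubleToCx_add w
  have hm : ∀ a, doubleToCx g a - Complex.I • doubleToCx g (𝒥.J a) ∈ 𝒥.L :=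
    fun a => (𝒥.mem_L_iff _).2 ⟨a, rfl⟩
  refine ⟨(1 / 2 : ℂ) • (doubleToCx g a - Complex.I • doubleToCx g (𝒥.J a)) + Complex.I •
    (1 / 2 : ℂ) • (doubleToCx g b - Complex.I • doubleToCx g (𝒥.J b)),
    add_mem (Submodule.smul_mem _ _ (hm a)) (Submodule.smul_mem _ _ (Submodule.smul_mem _ _ (hm b))),
    -- The real part of the component in the `-i`-eigenspace, `(1 + iJ)(a + ib)/2`.
    (1 / 2 : ℝ) • (a - 𝒥.J b), ?_⟩
  have hr : ∀ x : Double ℂ (Cx g), (1 / 2 : ℝ) • x = (1 / 2 : ℂ) • x := fun x => by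
    rw [← algebraMap_smul ℂ (1 / 2 : ℝ) x]; simp
  have hI : ∀ a : Double ℂ (Cx g), Complex.I • Complex.I • a = -a := fun a => by
    rw [smul_smul, Complex.I_mul_I, neg_one_smul]
  simp only [map_smul, map_sub, 𝒥.sq_eq, map_neg, hr, smul_sub, smul_comm Complex.I (1 / 2 : ℂ), hI]
  module

/-- The component of `v` in `conj L` is orthogonal to `L` by hypothesis and to `conj L` by isotropy,
hence zero by nondegeneracy. -/
lemma mem_L_of_cxPairing {v : Double ℂ (Cx g)} (h : ∀ u ∈ 𝒥.L, cxPairing v u = 0) : v ∈ 𝒥.L := by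
  obtain ⟨u, hu, c, rfl⟩ := 𝒥.exists_add_conj v
  suffices doubleToCx g c + Complex.I • doubleToCx g (𝒥.J c) = 0 by rwa [this, add_zero]
  apply eq_zero_of_cxPairing
  intro w
  obtain ⟨u', hu', c', rfl⟩ := 𝒥.exists_add_conj w
  rw [cxPairing_comm, cxPairing_add_left, cxPairing_conj_eq_zero, cxPairing_comm, add_zero]
  have := h u' hu'
  rwa [cxPairing_add_left, 𝒥.cxPairing_eq_zero hu hu', zero_add] at this

end GeneralizedComplexStructure

end Eigenspace
end GenComplex
end

noncomputable section

namespace GenComplex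

/-! ### Complex two-forms from alternating bilinear forms -/

section TwoFormOfBilinear

variable {g : Type*} [LieRing g] [LieAlgebra ℝ g]

lemma formsToCx_ι (α : Module.Dual ℝ g) :
    formsToCx g (ExteriorAlgebra.ι ℝ α) = ExteriorAlgebra.ι ℂ (formToCx g α) :=
  ExteriorAlgebra.lift_ι_apply ℝ _ _ α

lemma formsToCx_smul (z : ℝ) (y : ExteriorAlgebra ℝ (Module.Dual ℝ g)) :
    formsToCx g (z • y) = (z : ℂ) • formsToCx g y := by
  have : formsToCx g (algebraMap ℝ _ z) = algebraMap ℂ _ (z : ℂ) :=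
    (formsToCx g).commutes z
  rw [Algebra.smul_def, Algebra.smul_def, map_mul, this]

lemma formsToCx_mem {y : ExteriorAlgebra ℝ (Module.Dual ℝ g)} (hy : y ∈ ⋀[ℝ]^2 (Module.Dual ℝ g)) :
    formsToCx g y ∈ ⋀[ℂ]^2 (CxForm g) := by
  refine two_form_induction (p := fun y => formsToCx g y ∈ ⋀[ℂ]^2 (CxForm g)) (fun a b => ?_)
    (fun x y _ _ h₁ h₂ => by rw [map_add]; exact add_mem h₁ h₂) hy
  rw [map_mul, formsToCx_ι, formsToCx_ι]
  exact ι_mul_ι_mem_two_forms _ _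

variable [FiniteDimensional ℝ g]

lemma sum_coord_smul (X : Cx g) :
    ∑ i, formToCx g ((Module.finBasis ℝ g).coord i) X • ((1 : ℂ) ⊗ₜ[ℝ] Module.finBasis ℝ g i) =
      X := by
  induction X using TensorProduct.induction_on with
  | zero => simp
  | tmul z x =>
    conv_rhs => rw [← (Module.finBasis ℝ g).sum_repr x, TensorProduct.tmul_sum]
    refine Finset.sum_congr rfl fun i _ => ?_
    rw [formToCx_tmul, TensorProduct.smul_tmul', TensorProduct.tmul_smul, TensorProduct.smul_tmul']
    congr 1
    simp [mul_comm]
  | add X Y hX hY => simp only [map_add, add_smul, Finset.sum_add_distrib, hX, hY]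

/-- Every alternating bilinear form is given by contraction with a complex `2`-form. -/
lemma exists_two_form (A : Cx g →ₗ[ℂ] CxForm g) (hA : ∀ X, A X X = 0) :
    ∃ B ∈ ⋀[ℝ]^2 (Module.Dual ℝ g), ∃ ω ∈ ⋀[ℝ]^2 (Module.Dual ℝ g), ∀ X : Cx g,
      CliffordAlgebra.contractLeft (Module.Dual.eval ℂ (Cx g) X)
        (formsToCx g B + Complex.I • formsToCx g ω) = ExteriorAlgebra.ι ℂ (A X) := by
  let b := Module.finBasis ℝ g
  -- The factor `1/2` compensates for summing over ordered pairs; `B` and `ω` take the real and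
  -- imaginary parts.
  let c : Fin _ → Fin _ → ℂ := fun i j => (1 / 2 : ℂ) * A (1 ⊗ₜ b i) (1 ⊗ₜ b j)
  let y : Fin (Module.finrank ℝ g) → Fin (Module.finrank ℝ g) →
    ExteriorAlgebra ℝ (Module.Dual ℝ g) := fun i j =>
      ExteriorAlgebra.ι ℝ (b.coord i) * ExteriorAlgebra.ι ℝ (b.coord j)
  have hy : ∀ i j, y i j ∈ ⋀[ℝ]^2 (Module.Dual ℝ g) := fun i j => ι_mul_ι_mem_two_forms _ _
  refine ⟨∑ i, ∑ j, (c i j).re • y i j,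
    sum_mem fun i _ => sum_mem fun j _ => Submodule.smul_mem _ _ (hy i j),
    ∑ i, ∑ j, (c i j).im • y i j,
    sum_mem fun i _ => sum_mem fun j _ => Submodule.smul_mem _ _ (hy i j), fun X => ?_⟩
  let e : Fin (Module.finrank ℝ g) → CxForm g := fun i => formToCx g (b.coord i)
  have hσ : formsToCx g (∑ i, ∑ j, (c i j).re • y i j) +
      Complex.I • formsToCx g (∑ i, ∑ j, (c i j).im • y i j) =
      ∑ i, ∑ j, c i j • (ExteriorAlgebra.ι ℂ (e i) * ExteriorAlgebra.ι ℂ (e j)) := by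
    simp only [map_sum, formsToCx_smul, Finset.smul_sum, ← Finset.sum_add_distrib]
    refine Finset.sum_congr rfl fun i _ => Finset.sum_congr rfl fun j _ => ?_
    simp only [y, map_mul, formsToCx_ι]
    rw [smul_smul, ← add_smul]
    congr 1
    rw [mul_comm Complex.I, Complex.re_add_im]
  have hskew : ∀ X Y, A Y X = -A X Y := fun X Y => by
    have := hA (X + Y)
    simp only [map_add, LinearMap.add_apply, hA, zero_add, add_zero] at this
    exact eq_neg_of_add_eq_zero_left (by linear_combination this)
  have hcon : ∀ u v : CxForm g, CliffordAlgebra.contractLeft (Module.Dual.eval ℂ (Cx g) X)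
      (ExteriorAlgebra.ι ℂ u * ExteriorAlgebra.ι ℂ v) =
      u X • ExteriorAlgebra.ι ℂ v - v X • ExteriorAlgebra.ι ℂ u := fun u v => by
    refine (CliffordAlgebra.contractLeft_ι_mul (Q := 0) _ u _).trans ?_
    refine congrArg₂ _ rfl ?_
    refine (congrArg _ (CliffordAlgebra.contractLeft_ι (Q := 0) _ v)).trans ?_
    rw [← Algebra.commutes, ← Algebra.smul_def]
    rfl
  have hAX : A X = ∑ i, ∑ j, (e i X * A (1 ⊗ₜ b i) (1 ⊗ₜ b j)) • e j := by
    refine LinearMap.ext fun Y => ?_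
    conv_lhs => rw [← sum_coord_smul X, ← sum_coord_smul Y]
    simp only [map_sum, map_smul, LinearMap.sum_apply, LinearMap.smul_apply, smul_eq_mul,
      Finset.mul_sum]
    rw [Finset.sum_comm]
    refine Finset.sum_congr rfl fun i _ => Finset.sum_congr rfl fun j _ => ?_
    simp only [e, b]; ring
  rw [hσ]
  simp only [map_sum, map_smul, hcon, smul_sub, Finset.sum_sub_distrib, smul_smul]
  rw [Finset.sum_comm (f := fun i j => (c i j * e j X) • ExteriorAlgebra.ι ℂ (e i)), hAX]
  simp only [map_sum, map_smul, ← Finset.sum_sub_distrib, ← sub_smul]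
  refine Finset.sum_congr rfl fun i _ => Finset.sum_congr rfl fun j _ => ?_
  congr 1
  simp only [c]
  rw [hskew (1 ⊗ₜ b i) (1 ⊗ₜ b j)]
  ring

end TwoFormOfBilinear

/-! ### Associated forms are bases of the annihilator of `E` -/

section Associated

variable {g : Type*} [LieRing g] [LieAlgebra ℝ g]

namespace GeneralizedComplexStructure

variable (𝒥 : GeneralizedComplexStructure g)

/-- The projection of `L` to the complexification of `g`. -/
def E : Submodule ℂ (Cx g) := 𝒥.L.map (LinearMap.fst ℂ (Cx g) (CxForm g))

lemma mem_E_iff (X : Cx g) : X ∈ 𝒥.E ↔ ∃ ξ, (X, ξ) ∈ 𝒥.L := by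
  simp [E]

lemma mk_zero_mem_L_iff (ξ : CxForm g) : ((0, ξ) : Double ℂ (Cx g)) ∈ 𝒥.L ↔
    ξ ∈ 𝒥.E.dualAnnihilator := by
  rw [Submodule.mem_dualAnnihilator]
  constructor
  · intro h X hX
    obtain ⟨η, hη⟩ := (𝒥.mem_E_iff X).1 hX
    simpa [cxPairing] using 𝒥.cxPairing_eq_zero h hη
  · intro h
    refine 𝒥.mem_L_of_cxPairing fun u hu => ?_
    simpa [cxPairing] using h u.1 ((𝒥.mem_E_iff _).2 ⟨u.2, hu⟩)

/-- Over `X ∈ E` the covector in `L` is determined modulo `Ann E`, so its values on `E` are well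
defined. They are alternating by isotropy, and a projection onto `E` extends them to `g_ℂ`. -/
lemma exists_alternating : ∃ A : Cx g →ₗ[ℂ] CxForm g, (∀ X, A X X = 0) ∧
    ∀ X ∈ 𝒥.E, (X, A X) ∈ 𝒥.L := by
  obtain ⟨p, hp⟩ := 𝒥.E.exists_isCompl.imp fun _ h => h
  let q : Cx g →ₗ[ℂ] 𝒥.E := 𝒥.E.projectionOnto p hp
  have hq : ∀ X (hX : X ∈ 𝒥.E), q X = ⟨X, hX⟩ := fun X hX =>
    Submodule.projectionOnto_apply_left hp ⟨X, hX⟩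
  let f : 𝒥.L →ₗ[ℂ] 𝒥.E := (LinearMap.fst ℂ (Cx g) (CxForm g)).submoduleMap 𝒥.L
  obtain ⟨s, hs⟩ := f.exists_rightInverse_of_surjective
    (LinearMap.range_eq_top.2 (LinearMap.submoduleMap_surjective _ _))
  have hs1 : ∀ X : 𝒥.E, (s X).1.1 = X := fun X => congrArg Subtype.val (LinearMap.congr_fun hs X)
  let B : 𝒥.E →ₗ[ℂ] CxForm g := LinearMap.snd ℂ _ _ ∘ₗ 𝒥.L.subtype ∘ₗ s
  let A : Cx g →ₗ[ℂ] CxForm g := (LinearMap.lcomp ℂ ℂ (𝒥.E.subtype ∘ₗ q)) ∘ₗ B ∘ₗ q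
  have hA : ∀ X Y, A X Y = (s (q X)).1.2 (q Y) := fun X Y => rfl
  refine ⟨A, fun X => ?_, fun X hX => ?_⟩
  · have := 𝒥.cxPairing_eq_zero (s (q X)).2 (s (q X)).2
    rw [cxPairing, hs1] at this
    rw [hA]
    linear_combination this / 2
  · have hE : A X - (s ⟨X, hX⟩).1.2 ∈ 𝒥.E.dualAnnihilator := by
      rw [Submodule.mem_dualAnnihilator]
      intro Y hY
      rw [LinearMap.sub_apply, hA, hq X hX, hq Y hY, sub_self]
    have := add_mem (s ⟨X, hX⟩).2 ((𝒥.mk_zero_mem_L_iff _).2 hE)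
    convert this using 1
    exact Prod.ext (by simp [hs1]) (by simp)

/-- Elements of `L` are the `X + ξ` with `X ∈ E` and `ξ ≡ A X` modulo the span of the `θ`. They kill
`Ω e^σ` as soon as `i_X σ = -A X`. The annihilator of this nonzero spinor is isotropic and `L` is
maximal isotropic, so they coincide. -/
lemma isAssociated_of_span_eq [FiniteDimensional ℝ g] {k : ℕ} {θ : Fin k → CxForm g}
    (hθ : LinearIndependent ℂ θ)
    (hspan : Submodule.span ℂ (Set.range θ) = 𝒥.E.dualAnnihilator) : 𝒥.IsAssociated θ := by
  obtain ⟨A, hA0, hAL⟩ := 𝒥.exists_alternating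
  obtain ⟨B, hB, ω, hω, hσ⟩ := exists_two_form (-A) (by simp [hA0])
  have hmem : formsToCx g B + Complex.I • formsToCx g ω ∈ ⋀[ℂ]^2 (CxForm g) :=
    add_mem (formsToCx_mem hB) (Submodule.smul_mem _ _ (formsToCx_mem hω))
  refine ⟨B, hB, ω, hω, ?_⟩
  set σ := formsToCx g B + Complex.I • formsToCx g ω
  set Ω := ExteriorAlgebra.ιMulti ℂ k θ
  have hρ : Ω * IsNilpotent.exp σ = IsNilpotent.exp σ * Ω := (commute_exp_two_form hmem Ω).eq.symm
  have hne : Ω * IsNilpotent.exp σ ≠ 0 := fun h0 => ιMulti_ne_zero hθ <|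
    (IsNilpotent.isUnit_exp (isNilpotent_two_form hmem)).mul_left_eq_zero.1 h0
  have hle : 𝒥.L ≤ spinorAnnihilator (Ω * IsNilpotent.exp σ) := by
    rintro ⟨X, ξ⟩ hX
    have hXE : X ∈ 𝒥.E := (𝒥.mem_E_iff X).2 ⟨ξ, hX⟩
    have hξ : ξ - A X ∈ Submodule.span ℂ (Set.range θ) := by
      rw [hspan, ← 𝒥.mk_zero_mem_L_iff]
      convert sub_mem hX (hAL X hXE) using 1
      exact Prod.ext (by simp) rfl
    have hcon : CliffordAlgebra.contractLeft (Module.Dual.eval ℂ (Cx g) X) Ω = 0 :=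
      contractLeft_ιMulti _ θ fun j => by
        have : θ j ∈ 𝒥.E.dualAnnihilator := hspan ▸ Submodule.subset_span ⟨j, rfl⟩
        exact (Submodule.mem_dualAnnihilator _).1 this X hXE
    have hm : ExteriorAlgebra.ι ℂ (ξ - A X) * Ω = 0 := ι_mul_ιMulti θ hξ
    change clifford _ _ = 0
    rw [hρ, clifford_apply, contractLeft_exp_mul _ hmem, hσ, hcon, add_zero,
      ← mul_assoc (ExteriorAlgebra.ι ℂ ξ), ← (commute_exp_two_form hmem (ExteriorAlgebra.ι ℂ ξ)).eq, mul_assoc, ← mul_add, ← add_mul,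
      ← map_add, LinearMap.neg_apply, neg_add_eq_sub, hm, mul_zero]
  refine le_antisymm (fun u hu => 𝒥.mem_L_of_cxPairing fun v hv =>
    cxPairing_eq_zero_of_mem_spinorAnnihilator hne hu (hle hv)) hle

lemma IsAssociated.mem_dualAnnihilator {𝒥 : GeneralizedComplexStructure g} {k : ℕ}
    {θ : Fin k → CxForm g} (h : 𝒥.IsAssociated θ) (j : Fin k) : θ j ∈ 𝒥.E.dualAnnihilator := by
  obtain ⟨B, -, ω, -, h⟩ := h
  rw [← 𝒥.mk_zero_mem_L_iff, ← h]
  change clifford _ _ = 0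
  rw [clifford_apply, map_zero, map_zero, LinearMap.zero_apply, zero_add, ← mul_assoc,
    ι_mul_ιMulti θ (Submodule.subset_span ⟨j, rfl⟩), zero_mul]

/-- Dependent forms would make the spinor zero and its annihilator everything, whereas `L` is
isotropic for a nondegenerate pairing. -/
lemma IsAssociated.linearIndependent [Nontrivial g] {𝒥 : GeneralizedComplexStructure g} {k : ℕ}
    {θ : Fin k → CxForm g} (h : 𝒥.IsAssociated θ) : LinearIndependent ℂ θ := by
  by_contra hθ
  obtain ⟨B, -, ω, -, h⟩ := h
  have htop : 𝒥.L = ⊤ := by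
    rw [← h, AlternatingMap.map_linearDependent _ _ hθ, zero_mul, eq_top_iff]
    intro u _
    change clifford _ _ = 0
    rw [clifford_apply, map_zero, mul_zero, add_zero]
  obtain ⟨X, hX⟩ := exists_ne (0 : g)
  refine hX ?_
  have hv : ((1 : ℂ) ⊗ₜ[ℝ] X, (0 : CxForm g)) = 0 := eq_zero_of_cxPairing fun u =>
    𝒥.cxPairing_eq_zero (htop ▸ Submodule.mem_top) (htop ▸ Submodule.mem_top)
  have h1 : (1 : ℂ) ⊗ₜ[ℝ] X = 0 := congrArg Prod.fst hv
  rw [← Module.forall_dual_apply_eq_zero_iff ℝ]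
  intro f
  have := congrArg (formToCx g f) h1
  rw [formToCx_tmul] at this
  simpa using this

end GeneralizedComplexStructure

end Associated
end GenComplex
end

noncomputable section

namespace GenComplex

/-! ### Complex bracket, conjugation, and the complexified central series -/

section Bracket

variable {h : Type*} [LieRing h] [LieAlgebra ℂ h]

variable (h) in
/-- The bracket of a complex Lie algebra as a bilinear map. -/
def lieBr : h →ₗ[ℂ] h →ₗ[ℂ] h := (LieAlgebra.ad ℂ h : h →ₗ[ℂ] Module.End ℂ h)

lemma courant_fst (u v : Double ℂ h) : (courant u v).1 = lieBr h u.1 v.1 := rfl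

lemma lieBr_swap (X Y : h) : lieBr h X Y = -lieBr h Y X := (lie_skew X Y).symm

end Bracket

section Conjugation

variable (g : Type*) [LieRing g] [LieAlgebra ℝ g]

/-- Complex conjugation on the complexification of `g`. -/
def cxConj : Cx g →ₛₗ[starRingEnd ℂ] Cx g :=
  { LinearMap.rTensor g Complex.conjAe.toLinearMap with
    map_smul' := fun z X => by
      change LinearMap.rTensor g Complex.conjAe.toLinearMap _ =
        _ • LinearMap.rTensor g Complex.conjAe.toLinearMap X
      induction X using TensorProduct.induction_on with
      | zero => simp
      | tmul w x => simp [TensorProduct.smul_tmul']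
      | add X Y hX hY => rw [smul_add, map_add, hX, hY, map_add, smul_add] }

/-- The complexification of the descending central series. -/
def cxSeries (i : ℕ) : Submodule ℂ (Cx g) := (centralSeries g i).baseChange ℂ

variable {g}

lemma cxConj_tmul (z : ℂ) (x : g) : cxConj g (z ⊗ₜ x) = starRingEnd ℂ z ⊗ₜ x := rfl

lemma cxConj_cxConj (X : Cx g) : cxConj g (cxConj g X) = X := by
  induction X using TensorProduct.induction_on with
  | zero => simp
  | tmul w x => simp [cxConj_tmul]
  | add X Y hX hY => rw [map_add, map_add, hX, hY]

lemma lieBr_tmul (w z : ℂ) (x y : g) :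
    lieBr (Cx g) (w ⊗ₜ x) (z ⊗ₜ y) = (w * z) ⊗ₜ ⁅x, y⁆ := rfl

lemma cxConj_lieBr (X Y : Cx g) :
    cxConj g (lieBr (Cx g) X Y) = lieBr (Cx g) (cxConj g X) (cxConj g Y) := by
  induction X using TensorProduct.induction_on with
  | zero => simp
  | tmul w x =>
    induction Y using TensorProduct.induction_on with
    | zero => simp
    | tmul z y => simp only [cxConj_tmul, lieBr_tmul, map_mul]
    | add X Y hX hY => rw [map_add, map_add, map_add, map_add, hX, hY]
  | add X Y hX hY =>
    rw [map_add, map_add, map_add, LinearMap.add_apply, LinearMap.add_apply, map_add, hX, hY]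

lemma finrank_comap_cxConj (P : Submodule ℂ (Cx g)) :
    Module.finrank ℂ (P.comap (cxConj g)) = Module.finrank ℂ P := by
  let e : P.comap (cxConj g) ≃+ P :=
    { toFun := fun X => ⟨cxConj g X, X.2⟩
      invFun := fun X => ⟨cxConj g X, by
        rw [Submodule.mem_comap, cxConj_cxConj]; exact X.2⟩
      left_inv := fun X => Subtype.ext (cxConj_cxConj _)
      right_inv := fun X => Subtype.ext (cxConj_cxConj _)
      map_add' := fun X Y => Subtype.ext (map_add _ _ _) }
  exact congrArg Cardinal.toNat (rank_eq_of_equiv_equiv (starRingEnd ℂ) e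
    (starRingAut (R := ℂ)).bijective fun z X => Subtype.ext (map_smulₛₗ (cxConj g) z X.1))

lemma cxSeries_antitone : Antitone (cxSeries g) := fun _ _ hij =>
  Submodule.baseChange_mono ℂ fun _ hx => LieModule.antitone_lowerCentralSeries ℝ g g hij hx

lemma cxSeries_eq (i : ℕ) :
    cxSeries g i = (LieModule.lowerCentralSeries ℂ (Cx g) (Cx g) i).toSubmodule := by
  rw [LieSubmodule.lowerCentralSeries_tensor_eq_baseChange]; rfl

lemma lieBr_mem_cxSeries (X : Cx g) {Y : Cx g} {i : ℕ} (hY : Y ∈ cxSeries g i) :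
    lieBr (Cx g) X Y ∈ cxSeries g (i + 1) := by
  rw [cxSeries_eq] at hY ⊢
  rw [LieModule.lowerCentralSeries_succ]
  exact LieSubmodule.lie_mem_lie (LieSubmodule.mem_top X) hY

lemma cxSeries_succ_le {P : Submodule ℂ (Cx g)} {i : ℕ}
    (h : ∀ X, ∀ Y ∈ cxSeries g i, lieBr (Cx g) X Y ∈ P) : cxSeries g (i + 1) ≤ P := by
  rw [cxSeries_eq, LieModule.lowerCentralSeries_succ, LieSubmodule.lieIdeal_oper_eq_linear_span',
    Submodule.span_le]
  rintro _ ⟨X, -, Y, hY, rfl⟩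
  exact h X Y (by rwa [cxSeries_eq])

lemma cxConj_mem_cxSeries {X : Cx g} {i : ℕ} (hX : X ∈ cxSeries g i) :
    cxConj g X ∈ cxSeries g i := by
  rw [cxSeries, Submodule.baseChange_eq_span] at hX
  induction hX using Submodule.span_induction with
  | mem x hx =>
    obtain ⟨x, hx, rfl⟩ := hx
    exact Submodule.tmul_mem_baseChange_of_mem _ hx
  | zero => rw [map_zero]; exact zero_mem _
  | add x y _ _ hx hy => rw [map_add]; exact add_mem hx hy
  | smul a x _ hx => rw [map_smulₛₗ]; exact Submodule.smul_mem _ _ hx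

lemma finrank_cxSeries (i : ℕ) :
    Module.finrank ℂ (cxSeries g i) = Module.finrank ℝ (centralSeries g i) := by
  rw [← Module.finrank_baseChange (R := ℂ) (S := ℝ) (M' := centralSeries g i)]
  exact (LinearEquiv.ofBijective ((centralSeries g i).toBaseChange ℂ)
    ⟨Submodule.toBaseChange_injective .., Submodule.toBaseChange_surjective ℂ _⟩).finrank_eq.symm

/-- A complex form kills `gⁱ` exactly when its real and imaginary parts do. This gives access to
duality between sums and intersections. -/
lemma V_eq (i : ℕ) : V g i = (cxSeries g i).dualAnnihilator := by
  refine le_antisymm (Submodule.span_le.2 ?_) fun θ hθ => ?_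
  · rintro _ ⟨α, hα, rfl⟩
    rw [SetLike.mem_coe, Submodule.mem_dualAnnihilator] at hα ⊢
    intro X hX
    rw [cxSeries, Submodule.baseChange_eq_span] at hX
    induction hX using Submodule.span_induction with
    | mem x hx =>
      obtain ⟨x, hx, rfl⟩ := hx
      simp [formToCx_tmul, hα x hx]
    | zero => rw [map_zero]
    | add x y _ _ hx hy => rw [map_add, hx, hy, add_zero]
    | smul a x _ hx => rw [map_smul, hx, smul_zero]
  · obtain ⟨α, β, rfl, h⟩ := exists_formToCx_add θ
    have h0 : ∀ x ∈ centralSeries g i, α x = 0 ∧ β x = 0 := fun x hx => by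
      have := h x
      rw [(Submodule.mem_dualAnnihilator _).1 hθ _ (Submodule.tmul_mem_baseChange_of_mem _ hx)] at this
      have h1 := congrArg Complex.re this
      have h2 := congrArg Complex.im this
      simp at h1 h2
      exact ⟨h1.symm, h2.symm⟩
    refine add_mem (Submodule.subset_span ⟨α, ?_, rfl⟩)
      (Submodule.smul_mem _ _ (Submodule.subset_span ⟨β, ?_, rfl⟩))
    · exact (Submodule.mem_dualAnnihilator _).2 fun x hx => (h0 x hx).1
    · exact (Submodule.mem_dualAnnihilator _).2 fun x hx => (h0 x hx).2

lemma V_mono : Monotone (V g) := fun i j hij => by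
  rw [V_eq, V_eq]; exact Submodule.dualAnnihilator_anti (cxSeries_antitone hij)

end Conjugation

/-! ### Subalgebras `E` with `E + conj E = g_ℂ` -/

section Subalgebra

variable {g : Type*} [LieRing g] [LieAlgebra ℝ g] {E : Submodule ℂ (Cx g)}

/-- If `gⁱ ⊆ E + gⁱ⁺¹` and the next graded piece is at most a line, then
`gⁱ⁺¹ ⊆ E + gⁱ⁺²`. -/
lemma cxSeries_succ_le_sup [FiniteDimensional ℝ g] (hE : E ⊔ E.comap (cxConj g) = ⊤)
    (hlie : ∀ X ∈ E, ∀ Y ∈ E, lieBr (Cx g) X Y ∈ E) {i : ℕ} (hi : cxSeries g i ≤ E ⊔ cxSeries g (i + 1))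
    (hdim : Module.finrank ℂ (cxSeries g (i + 1)) ≤ Module.finrank ℂ (cxSeries g (i + 2)) + 1) :
    cxSeries g (i + 1) ≤ E ⊔ cxSeries g (i + 2) := by
  have hanti : ∀ j, cxSeries g (j + 1) ≤ cxSeries g j := fun j => cxSeries_antitone j.le_succ
  -- Bracket `e + e'`, with `e ∈ E` and `e' ∈ conj E`, against `Y ∈ gⁱ`. Modulo `gⁱ⁺¹`, `Y` has a
  -- representative in `E` and, by conjugation, one in `conj E`: use the former with `e`, the latter
  -- with `e'`.
  have hP : cxSeries g (i + 1) ≤ (E ⊓ cxSeries g (i + 1)) ⊔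
      (E.comap (cxConj g) ⊓ cxSeries g (i + 1)) ⊔ cxSeries g (i + 2) := by
    refine cxSeries_succ_le fun X Y hY => ?_
    have hX : X ∈ E ⊔ E.comap (cxConj g) := hE ▸ Submodule.mem_top
    obtain ⟨e, he, e', he', rfl⟩ := Submodule.mem_sup.1 hX
    rw [map_add, LinearMap.add_apply]
    refine add_mem ?_ ?_
    · obtain ⟨u, hu, v, hv, rfl⟩ := Submodule.mem_sup.1 (hi hY)
      have hu' : u ∈ cxSeries g i := by simpa using sub_mem hY (hanti i hv)
      rw [map_add]
      exact add_mem
        (Submodule.mem_sup_left (Submodule.mem_sup_left ⟨hlie e he u hu, lieBr_mem_cxSeries e hu'⟩))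
        (Submodule.mem_sup_right (lieBr_mem_cxSeries e hv))
    · obtain ⟨u, hu, v, hv, huv⟩ := Submodule.mem_sup.1 (hi (cxConj_mem_cxSeries hY))
      have hYuv : Y = cxConj g u + cxConj g v := by rw [← map_add, huv, cxConj_cxConj]
      have hu' : u ∈ cxSeries g i := by
        simpa [← huv] using sub_mem (cxConj_mem_cxSeries hY) (hanti i hv)
      rw [hYuv, map_add]
      refine add_mem (Submodule.mem_sup_left (Submodule.mem_sup_right
        ⟨?_, lieBr_mem_cxSeries _ (cxConj_mem_cxSeries hu')⟩))
        (Submodule.mem_sup_right (lieBr_mem_cxSeries _ (cxConj_mem_cxSeries hv)))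
      change cxConj g _ ∈ E
      rw [cxConj_lieBr, cxConj_cxConj]
      exact hlie _ he' u hu
  -- In the graded piece, of dimension at most one, the image of `E ∩ gⁱ⁺¹` is either zero, and then
  -- so is that of its conjugate and the piece vanishes, or it is the whole line.
  by_cases h : E ⊓ cxSeries g (i + 1) ≤ cxSeries g (i + 2)
  · have h' : E.comap (cxConj g) ⊓ cxSeries g (i + 1) ≤ cxSeries g (i + 2) := fun X hX => by
      rw [← cxConj_cxConj X]
      exact cxConj_mem_cxSeries (h ⟨hX.1, cxConj_mem_cxSeries hX.2⟩)
    exact (hP.trans (sup_le (sup_le h h') le_rfl)).trans le_sup_right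
  · have hlt : cxSeries g (i + 2) < (E ⊓ cxSeries g (i + 1)) ⊔ cxSeries g (i + 2) :=
      lt_of_le_of_ne le_sup_right fun h' => h (h' ▸ le_sup_left)
    have := Submodule.finrank_lt_finrank_of_lt hlt
    have heq : (E ⊓ cxSeries g (i + 1)) ⊔ cxSeries g (i + 2) = cxSeries g (i + 1) :=
      Submodule.eq_of_le_of_finrank_le (sup_le inf_le_right (hanti _)) (by omega)
    rw [← heq]
    exact sup_le_sup_right inf_le_left _

/-- A nilpotent Lie algebra is generated by any complement of its derived algebra: by induction, `E`
fills `g_ℂ` modulo every term of the series. -/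
lemma eq_top_of_sup_cxSeries_one (hlie : ∀ X ∈ E, ∀ Y ∈ E, lieBr (Cx g) X Y ∈ E)
    (h : E ⊔ cxSeries g 1 = ⊤) {m : ℕ} (hm : cxSeries g m = ⊥) : E = ⊤ := by
  have key : ∀ j, E ⊔ cxSeries g (j + 1) = ⊤ := by
    intro j
    induction j with
    | zero => exact h
    | succ j ih =>
      refine top_le_iff.1 (h.ge.trans (sup_le le_sup_left (cxSeries_succ_le fun X Y _ => ?_)))
      have hX : X ∈ E ⊔ cxSeries g (j + 1) := ih ▸ Submodule.mem_top
      have hY : Y ∈ E ⊔ cxSeries g (j + 1) := ih ▸ Submodule.mem_top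
      obtain ⟨e, he, v, hv, rfl⟩ := Submodule.mem_sup.1 hX
      obtain ⟨e', he', v', hv', rfl⟩ := Submodule.mem_sup.1 hY
      rw [map_add (lieBr (Cx g)), LinearMap.add_apply, map_add (lieBr (Cx g) e), lieBr_swap v]
      exact add_mem (add_mem (Submodule.mem_sup_left (hlie _ he _ he'))
        (Submodule.mem_sup_right (lieBr_mem_cxSeries _ hv')))
        (neg_mem (Submodule.mem_sup_right (lieBr_mem_cxSeries _ hv)))
  have := key m
  rwa [le_bot_iff.1 ((cxSeries_antitone m.le_succ).trans hm.le), sup_bot_eq] at this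

lemma finrank_dualAnnihilator_inf_V [FiniteDimensional ℝ g] (i : ℕ) :
    Module.finrank ℂ (E.dualAnnihilator ⊓ V g i : Submodule ℂ (CxForm g)) +
      Module.finrank ℂ (E ⊔ cxSeries g i : Submodule ℂ (Cx g)) = Module.finrank ℝ g := by
  rw [V_eq, ← Submodule.dualAnnihilator_sup_eq, add_comm,
    Subspace.finrank_add_finrank_dualAnnihilator_eq, Module.finrank_baseChange]

/-- `F = E + gⁱ` and `conj F` have equal dimension, span `g_ℂ`, and meet in at least `gⁱ`; compare
dimensions and pass to annihilators. -/
lemma two_mul_finrank_le [FiniteDimensional ℝ g] (hE : E ⊔ E.comap (cxConj g) = ⊤) (i : ℕ) :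
    2 * Module.finrank ℂ (E.dualAnnihilator ⊓ V g i : Submodule ℂ (CxForm g)) +
      Module.finrank ℝ (centralSeries g i) ≤ Module.finrank ℝ g := by
  let F := E ⊔ cxSeries g i
  have h1 := Submodule.finrank_sup_add_finrank_inf_eq F (F.comap (cxConj g))
  have htop : F ⊔ F.comap (cxConj g) = ⊤ := top_le_iff.1 <| hE.ge.trans <|
    sup_le_sup le_sup_left (Submodule.comap_mono le_sup_left)
  have hle : cxSeries g i ≤ F ⊓ F.comap (cxConj g) := le_inf le_sup_right fun X hX =>
    (le_sup_right : cxSeries g i ≤ F) (cxConj_mem_cxSeries hX)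
  have h2 := Submodule.finrank_mono hle
  have h3 := finrank_dualAnnihilator_inf_V (E := E) i
  rw [htop, finrank_top, Module.finrank_baseChange, finrank_comap_cxConj] at h1
  rw [finrank_cxSeries] at h2
  change _ + Module.finrank ℂ F = _ at h3
  omega

/-- `(E + B)/(E + A)` is a quotient of `B/A`. This bounds the jumps of the filtration. -/
lemma finrank_sup_add_le {K W : Type*} [Field K] [AddCommGroup W] [Module K W]
    [FiniteDimensional K W] (E : Submodule K W) {A B : Submodule K W} (h : A ≤ B) :
    Module.finrank K (E ⊔ B : Submodule K W) + Module.finrank K A ≤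
      Module.finrank K (E ⊔ A : Submodule K W) + Module.finrank K B := by
  have h1 := Submodule.finrank_sup_add_finrank_inf_eq (E ⊔ A) B
  rw [sup_assoc, sup_eq_right.2 h] at h1
  have h2 := Submodule.finrank_mono (le_inf le_sup_right h : A ≤ (E ⊔ A) ⊓ B)
  omega

end Subalgebra

/-! ### The projection `E` is such a subalgebra, of codimension the type -/

namespace GeneralizedComplexStructure

variable {g : Type*} [LieRing g] [LieAlgebra ℝ g] (𝒥 : GeneralizedComplexStructure g)

lemma lieBr_mem_E {X Y : Cx g} (hX : X ∈ 𝒥.E) (hY : Y ∈ 𝒥.E) : lieBr (Cx g) X Y ∈ 𝒥.E := by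
  obtain ⟨ξ, hξ⟩ := (𝒥.mem_E_iff X).1 hX
  obtain ⟨η, hη⟩ := (𝒥.mem_E_iff Y).1 hY
  have h := Submodule.mem_map_of_mem (f := LinearMap.fst ℂ (Cx g) (CxForm g))
    (𝒥.involutive _ hξ _ hη)
  rwa [LinearMap.fst_apply, courant_fst] at h

/-- For real `x`, projecting `x - iJx ∈ L` gives `x - iq ∈ E` with `q` real, and `x` is the average
of this vector and its conjugate. -/
lemma E_sup_conj : 𝒥.E ⊔ 𝒥.E.comap (cxConj g) = ⊤ := by
  have key : ∀ p q : Cx g, cxConj g p = p → cxConj g q = q → p - Complex.I • q ∈ 𝒥.E →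
      p ∈ 𝒥.E ⊔ 𝒥.E.comap (cxConj g) := fun p q hp hq h => by
    have hpq : p = (1 / 2 : ℂ) • (p - Complex.I • q) + (1 / 2 : ℂ) • (p + Complex.I • q) := by
      module
    rw [hpq]
    refine add_mem (Submodule.mem_sup_left (Submodule.smul_mem _ _ h))
      (Submodule.mem_sup_right (Submodule.smul_mem _ _ ?_))
    rw [Submodule.mem_comap, map_add, map_smulₛₗ, hp, hq, Complex.conj_I, neg_smul,
      ← sub_eq_add_neg]
    exact h
  have hreal : ∀ x : g, cxConj g ((1 : ℂ) ⊗ₜ x) = 1 ⊗ₜ x := fun x => by rw [cxConj_tmul, map_one]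
  have h1 : ∀ x : g, (1 : ℂ) ⊗ₜ[ℝ] x ∈ 𝒥.E ⊔ 𝒥.E.comap (cxConj g) := fun x =>
    key _ _ (hreal x) (hreal (𝒥.J (x, 0)).1)
      ((𝒥.mem_E_iff _).2 ⟨_, (𝒥.mem_L_iff _).2 ⟨(x, 0), rfl⟩⟩)
  refine eq_top_iff.2 fun X _ => ?_
  obtain ⟨a, b, rfl⟩ := exists_tmul_add X
  exact add_mem (h1 a) (Submodule.smul_mem _ _ (h1 b))

lemma type_eq [FiniteDimensional ℝ g] : 𝒥.type = Module.finrank ℂ 𝒥.E.dualAnnihilator := by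
  have h1 : Module.finrank ℂ 𝒥.E + Module.finrank ℂ 𝒥.E.dualAnnihilator =
    Module.finrank ℂ (Cx g) := Subspace.finrank_add_finrank_dualAnnihilator_eq 𝒥.E
  have h2 : Module.finrank ℂ (Cx g ⧸ 𝒥.E) + Module.finrank ℂ 𝒥.E = Module.finrank ℂ (Cx g) :=
    𝒥.E.finrank_quotient_add_finrank
  have h3 : 𝒥.type = Module.finrank ℂ (Cx g ⧸ 𝒥.E) := rfl
  omega

end GeneralizedComplexStructure
end GenComplex
end

noncomputable section

namespace GenComplex

/-! ### Bases adapted to a filtration -/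

section Adapted

variable {K W : Type*} [Field K] [AddCommGroup W] [Module K W] [FiniteDimensional K W]

lemma exists_linearIndependent_mem (F : ℕ → Submodule K W) (a : ℕ → ℕ) (k : ℕ)
    (h : ∀ j < k, j < Module.finrank K (F (a j))) :
    ∃ f : Fin k → W, LinearIndependent K f ∧ ∀ j : Fin k, f j ∈ F (a j) := by
  induction k with
  | zero => exact ⟨Fin.elim0, linearIndependent_empty_type, fun j => j.elim0⟩
  | succ k ih =>
    obtain ⟨f, hf, hfF⟩ := ih fun j hj => h j (hj.trans k.lt_succ_self)
    have hnle : ¬ F (a k) ≤ Submodule.span K (Set.range f) := fun hle => by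
      have h1 := Submodule.finrank_mono hle
      rw [finrank_span_eq_card hf, Fintype.card_fin] at h1
      exact absurd (h k k.lt_succ_self) (by omega)
    obtain ⟨v, hv, hvn⟩ := SetLike.not_le_iff_exists.1 hnle
    refine ⟨Fin.snoc f v, linearIndependent_finSnoc.2 ⟨hf, hvn⟩, fun j => ?_⟩
    refine Fin.lastCases ?_ (fun i => ?_) j
    · simpa using hv
    · simpa using hfF i

variable {F : ℕ → Submodule K W} {a : ℕ → ℕ} {k : ℕ} {f : Fin k → W}

/-- Here `a j` is the first index at which `dim F` exceeds `j`, so the first `dim F_i` vectors lie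
in `F_i` and are a basis of it by counting. -/
lemma span_image_eq_of_adapted (hF : Monotone F) (hf : LinearIndependent K f)
    (hfF : ∀ j : Fin k, f j ∈ F (a j)) (ha : ∀ j < k, ∀ i, j < Module.finrank K (F i) → a j ≤ i)
    (hk : ∀ i, Module.finrank K (F i) ≤ k) (i : ℕ) :
    Submodule.span K (f '' {j | (j : ℕ) < Module.finrank K (F i)}) = F i := by
  refine Submodule.eq_of_le_of_finrank_le (Submodule.span_le.2 ?_) ?_
  · rintro _ ⟨j, hj, rfl⟩
    exact hF (ha j j.2 i hj) (hfF j)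
  · let c : Fin (Module.finrank K (F i)) → Fin k := Fin.castLE (hk i)
    have hc : LinearIndependent K (f ∘ c) := hf.comp c (Fin.castLE_injective _)
    have h1 := finrank_span_eq_card hc
    rw [Fintype.card_fin] at h1
    refine h1.ge.trans (Submodule.finrank_mono (Submodule.span_mono ?_))
    rintro _ ⟨j, rfl⟩
    exact ⟨c j, j.2, rfl⟩

lemma mem_iff_of_adapted (hF : Monotone F) (hf : LinearIndependent K f)
    (hfF : ∀ j : Fin k, f j ∈ F (a j)) (ha : ∀ j < k, ∀ i, j < Module.finrank K (F i) → a j ≤ i)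
    (hk : ∀ i, Module.finrank K (F i) ≤ k) (i : ℕ) (j : Fin k) :
    f j ∈ F i ↔ (j : ℕ) < Module.finrank K (F i) := by
  refine ⟨fun h => ?_, fun h => hF (ha j j.2 i h) (hfF j)⟩
  rw [← span_image_eq_of_adapted hF hf hfF ha hk i] at h
  by_contra hj
  exact hf.notMem_span_image (s := {j | (j : ℕ) < Module.finrank K (F i)}) hj h

lemma linearIndependent_mkQ_of_adapted (hF : Monotone F) (hf : LinearIndependent K f)
    (hfF : ∀ j : Fin k, f j ∈ F (a j)) (ha : ∀ j < k, ∀ i, j < Module.finrank K (F i) → a j ≤ i)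
    (hk : ∀ i, Module.finrank K (F i) ≤ k) (i : ℕ) {U : Submodule K W}
    (hU : ∀ w ∈ Submodule.span K (Set.range f), w ∈ U → w ∈ F i) {p : Fin k → Prop}
    (hp : ∀ j, p j → f j ∉ F i) :
    LinearIndependent K (fun j : {j // p j} => U.mkQ (f j.1)) := by
  have hli : LinearIndependent K (fun j : {j // p j} => f j.1) :=
    hf.comp _ Subtype.val_injective
  refine hli.map (f := U.mkQ) ?_
  rw [Submodule.ker_mkQ, Submodule.disjoint_def]
  intro w hw hwU
  have hrange : Set.range (fun j : {j // p j} => f j.1) ⊆ f '' {j | p j} := by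
    rintro _ ⟨j, rfl⟩
    exact ⟨j.1, j.2, rfl⟩
  have h1 : w ∈ Submodule.span K (f '' {j | p j}) := Submodule.span_mono hrange hw
  have h2 : w ∈ F i := hU w (Submodule.span_mono (Set.image_subset_range _ _) h1) hwU
  rw [← span_image_eq_of_adapted hF hf hfF ha hk i] at h2
  refine Submodule.disjoint_def.1 (hf.disjoint_span_image (Set.disjoint_left.2 ?_)) w h1 h2
  exact fun j hj hj' => hp j hj ((mem_iff_of_adapted hF hf hfF ha hk i j).2 hj')

end Adapted

/-! ### Combinatorics of the dimension sequence -/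

section Degrees

/-- The numerical constraints on the dimensions `d i` of the spaces of forms of nilpotency degree at
most `i` force the jumps of `d` to be at one of the two sequences. -/
lemma degrees_of_dimensions {d : ℕ → ℕ} {r m k : ℕ} (hr : 3 ≤ r) (hrm : r ≤ m) (hd : Monotone d)
    (hd0 : d 0 = 0) (hdm : d m = k) (hd2 : d 2 ≤ 1) (hd1 : d 1 = 0 → k = 0)
    (hstep : ∀ i < m, d (i + 1) ≤ d i + if i + 1 = 1 ∨ i + 1 = r then 2 else 1)
    (hconst : ∀ i, i + 1 < m → i + 2 ≠ r → d (i + 1) = d i → d (i + 2) = d (i + 1)) :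
    ∃ a : ℕ → ℕ, (a = firstDegrees r ∨ a = secondDegrees r) ∧
      ∀ j < k, j < d (a j) ∧ ∀ i, j < d i → a j ≤ i := by
  rcases Nat.eq_zero_or_pos k with rfl | hk
  · exact ⟨firstDegrees r, .inl rfl, fun j hj => absurd hj (by omega)⟩
  have h12 := hd (show 1 ≤ 2 by omega)
  have hd1' : d 1 = 1 := by
    rcases Nat.eq_zero_or_pos (d 1) with h | h
    · have := hd1 h; omega
    · omega
  have hlow : ∀ i, i + 2 < r → d (i + 2) = 1 ∧ d (i + 1) = 1 := by
    intro i
    induction i with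
    | zero => intro _; exact ⟨le_antisymm hd2 (hd1'.ge.trans h12), hd1'⟩
    | succ i ih =>
      intro hi
      obtain ⟨h1, h2⟩ := ih (by omega)
      have := hconst (i + 1) (by omega) (by omega) (by rw [h1, h2])
      exact ⟨this.trans h1, h1⟩
  have hlow' : ∀ i, i < r → d i ≤ 1 := fun i hi => by
    obtain ⟨s, rfl⟩ : ∃ s, r = s + 3 := ⟨r - 3, by omega⟩
    exact (hd (show i ≤ s + 2 by omega)).trans (hlow s (by omega)).1.le
  have hprev : d (r - 1) = 1 := by
    obtain ⟨s, rfl⟩ : ∃ s, r = s + 3 := ⟨r - 3, by omega⟩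
    exact (hlow s (by omega)).1
  have hconst' : ∀ i, r ≤ i + 1 → d (i + 1) = d i → ∀ t, i + 1 + t ≤ m → d (i + 1 + t) = d (i + 1) := by
    intro i hi heq t
    suffices i + 1 + t ≤ m → d (i + 1 + t) = d (i + 1) ∧ d (i + 1 + t) = d (i + t) from
      fun h => (this h).1
    induction t with
    | zero => exact fun _ => ⟨rfl, heq⟩
    | succ t ih =>
      intro ht
      obtain ⟨h1, h2⟩ := ih (by omega)
      have h3 := hconst (i + t) (by omega) (by omega) (by rw [← h2]; congr 1; omega)
      have e1 : i + t + 2 = i + 1 + (t + 1) := by omega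
      have e2 : i + t + 1 = i + 1 + t := by omega
      have e3 : i + (t + 1) = i + 1 + t := by omega
      rw [e1, e2] at h3
      rw [e3]
      exact ⟨h3.trans h1, h3⟩
  -- The value `d r ∈ {1, 2, 3}` decides everything: `3` leads to the second sequence, `1` and `2`
  -- to the first.
  have hre : d r ≤ 3 := by
    have := hstep (r - 1) (by omega)
    rw [show r - 1 + 1 = r by omega, hprev] at this
    split_ifs at this <;> omega
  have hr1 : 1 ≤ d r := hprev.ge.trans (hd (by omega))
  have hk1 : d r = 1 → k = 1 := fun h => by
    have := hconst' (r - 1) (by omega) (by rw [show r - 1 + 1 = r by omega, h, hprev]) (m - r)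
      (by omega)
    rw [show r - 1 + 1 + (m - r) = m by omega, show r - 1 + 1 = r by omega] at this
    omega
  have hhigh : ∀ t, r + t ≤ m → d (r + t) ≤ d r + t ∧ (d (r + t) = d r + t ∨ d (r + t) = k) := by
    intro t
    induction t with
    | zero => exact fun _ => ⟨le_rfl, .inl rfl⟩
    | succ t ih =>
      intro ht
      obtain ⟨h1, h2⟩ := ih (by omega)
      have h3 := hstep (r + t) (by omega)
      rw [if_neg (by omega)] at h3
      have h4 := hd (show r + t ≤ r + t + 1 by omega)
      have h5 := hd ht
      rw [hdm] at h5
      rw [← add_assoc] at h5 ⊢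
      refine ⟨by omega, ?_⟩
      rcases eq_or_ne (d (r + t + 1)) (d (r + t)) with h | h
      · have := hconst' (r + t) (by omega) h (m - (r + t + 1)) (by omega)
        rw [show r + t + 1 + (m - (r + t + 1)) = m by omega] at this
        omega
      · omega
  -- A uniform formula for both sequences: the subtraction truncates to `0` for the `j < d r`, whose
  -- first index is `r`; each later `j` costs one more step.
  have main : ∀ a : ℕ → ℕ, a 0 = 1 → (∀ j, 1 ≤ j → 2 ≤ d r → a j = r + (j + 1 - d r)) →
      ∀ j < k, j < d (a j) ∧ ∀ i, j < d i → a j ≤ i := by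
    intro a ha0 ha j hj
    rcases Nat.eq_zero_or_pos j with rfl | hj0
    · rw [ha0, hd1']
      refine ⟨one_pos, fun i hi => ?_⟩
      by_contra h
      rw [show i = 0 by omega, hd0] at hi
      omega
    · have hr2 : 2 ≤ d r := by
        by_contra h
        have := hk1 (by omega)
        omega
      rw [ha j hj0 hr2]
      have hm := (hhigh (m - r) (by omega)).1
      rw [show r + (m - r) = m by omega, hdm] at hm
      refine ⟨?_, fun i hi => ?_⟩
      · have := (hhigh (j + 1 - d r) (by omega)).2
        omega
      · by_contra! h
        rcases lt_or_ge i r with hir | hir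
        · have := hlow' i hir
          omega
        · have := (hhigh (i - r) (by omega)).1
          rw [show r + (i - r) = i by omega] at this
          omega
  rcases (show d r = 3 ∨ d r < 3 by omega) with h3 | h3
  · refine ⟨secondDegrees r, .inr rfl, main _ rfl fun j hj _ => ?_⟩
    obtain _ | _ | j := j
    · omega
    · simp [secondDegrees, h3]
    · simp only [secondDegrees]; omega
  · refine ⟨firstDegrees r, .inl rfl, main _ rfl fun j hj _ => ?_⟩
    obtain _ | j := j
    · omega
    · simp only [firstDegrees]; omega

lemma firstDegrees_mono {r : ℕ} (hr : 1 ≤ r) : Monotone (firstDegrees r) :=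
  monotone_nat_of_le_succ fun i => by
    cases i <;> simp only [firstDegrees] <;> omega

lemma secondDegrees_mono {r : ℕ} (hr : 1 ≤ r) : Monotone (secondDegrees r) :=
  monotone_nat_of_le_succ fun i => by
    obtain _ | _ | i := i <;> simp only [secondDegrees] <;> omega

end Degrees

/-! ### Dimensions of the central series in form `t_r` -/

section Dimensions

variable {g : Type*} [LieRing g] [LieAlgebra ℝ g]

lemma finrank_centralSeries_succ [FiniteDimensional ℝ g] (i : ℕ) :
    Module.finrank ℝ (centralSeries g i) =
      Module.finrank ℝ (centralSeries g (i + 1)) + gradedDim g i := by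
  have hle : centralSeries g (i + 1) ≤ centralSeries g i :=
    LieModule.antitone_lowerCentralSeries ℝ g g i.le_succ
  have h := ((centralSeries g (i + 1)).submoduleOf (centralSeries g i)).finrank_quotient_add_finrank
  rw [← (Submodule.submoduleOfEquivOfLe hle).finrank_eq, ← h, add_comm]
  rfl

lemma centralSeries_nilindex (hqf : IsQuasiFiliform g) : centralSeries g (nilindex g) = ⊥ := by
  have : {m : ℕ | centralSeries g m = ⊥}.Nonempty := by
    obtain ⟨hnil, -⟩ := hqf
    obtain ⟨m, hm⟩ := (LieModule.isNilpotent_iff ℝ g g).1 hnil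
    exact ⟨m, by rw [Set.mem_ofPred_eq, centralSeries, hm]; rfl⟩
  exact Nat.sInf_mem this

lemma cxSeries_nilindex (hqf : IsQuasiFiliform g) : cxSeries g (nilindex g) = ⊥ := by
  rw [cxSeries, centralSeries_nilindex hqf, Submodule.baseChange_bot]

lemma mem_V_nilDegree (hqf : IsQuasiFiliform g) (θ : CxForm g) : θ ∈ V g (nilDegree θ) := by
  have : {i : ℕ | θ ∈ V g i}.Nonempty := ⟨nilindex g, by
    rw [Set.mem_ofPred_eq, V_eq, cxSeries_nilindex hqf, Submodule.dualAnnihilator_bot]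
    exact Submodule.mem_top⟩
  exact Nat.sInf_mem this

lemma nilDegree_le_iff (hqf : IsQuasiFiliform g) (θ : CxForm g) (i : ℕ) :
    nilDegree θ ≤ i ↔ θ ∈ V g i :=
  ⟨fun h => V_mono h (mem_V_nilDegree hqf θ), fun h => Nat.sInf_le h⟩

lemma finrank_centralSeries_zero : Module.finrank ℝ (centralSeries g 0) = Module.finrank ℝ g := by
  rw [centralSeries, LieModule.lowerCentralSeries_zero]
  exact finrank_top ℝ g

/-- Equality holds for `1 ≤ i ≤ m`; the inequality also covers `i = 0` and, since `dim g = m + 2`,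
the indices past the nilindex. -/
lemma finrank_le_centralSeries_add [FiniteDimensional ℝ g] {r : ℕ} (hr : 3 ≤ r) (hqf : IsQuasiFiliform g)
    (hform : IsOfFormT g r) (i : ℕ) :
    Module.finrank ℝ g ≤ Module.finrank ℝ (centralSeries g i) + i + if i < r then 1 else 2 := by
  obtain ⟨-, hrm, hform⟩ := hform
  induction i with
  | zero => rw [finrank_centralSeries_zero]; omega
  | succ i ih =>
    rcases lt_or_ge i (nilindex g) with hi | hi
    · have h1 := finrank_centralSeries_succ (g := g) i
      have h2 := hform i hi
      simp only at h2
      obtain rfl | hi0 := Nat.eq_zero_or_pos i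
      · rw [finrank_centralSeries_zero] at h1
        simp at h2
        split_ifs <;> omega
      · split_ifs at * <;> omega
    · have := hqf.2
      rw [if_neg (by omega)]
      omega

end Dimensions

/-! ### The filtration of the annihilator and its degrees -/

namespace GeneralizedComplexStructure

variable {g : Type*} [LieRing g] [LieAlgebra ℝ g] (𝒥 : GeneralizedComplexStructure g)

/-- The annihilator of the projection of `L`, filtered by the nilpotency degree. -/
def annFiltration (i : ℕ) : Submodule ℂ (CxForm g) := 𝒥.E.dualAnnihilator ⊓ V g i

lemma annFiltration_mono : Monotone 𝒥.annFiltration := fun _ _ h => inf_le_inf_left _ (V_mono h)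

variable [FiniteDimensional ℝ g]

lemma two_mul_finrank_annFiltration_le {r : ℕ} (hr : 3 ≤ r) (hqf : IsQuasiFiliform g)
    (hform : IsOfFormT g r) (i : ℕ) :
    2 * Module.finrank ℂ (𝒥.annFiltration i) ≤ i + if i < r then 1 else 2 := by
  have h1 := two_mul_finrank_le 𝒥.E_sup_conj i
  have h2 := finrank_le_centralSeries_add hr hqf hform i
  change 2 * Module.finrank ℂ (𝒥.annFiltration i) + _ ≤ _ at h1
  omega

lemma finrank_annFiltration_add (i : ℕ) : Module.finrank ℂ (𝒥.annFiltration i) +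
    Module.finrank ℂ (𝒥.E ⊔ cxSeries g i : Submodule ℂ (Cx g)) = Module.finrank ℝ g :=
  finrank_dualAnnihilator_inf_V i

lemma exists_degrees {r : ℕ} (hr : 3 ≤ r) (hqf : IsQuasiFiliform g) (hform : IsOfFormT g r) :
    ∃ a : ℕ → ℕ, (a = firstDegrees r ∨ a = secondDegrees r) ∧
      ∀ j < 𝒥.type, j < Module.finrank ℂ (𝒥.annFiltration (a j)) ∧
        ∀ i, j < Module.finrank ℂ (𝒥.annFiltration i) → a j ≤ i := by
  have hadd := 𝒥.finrank_annFiltration_add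
  have hm : 𝒥.annFiltration (nilindex g) = 𝒥.E.dualAnnihilator := by
    rw [annFiltration, V_eq, cxSeries_nilindex hqf, Submodule.dualAnnihilator_bot, inf_top_eq]
  have hsucc : ∀ i < nilindex g, Module.finrank ℂ (cxSeries g i) =
      Module.finrank ℂ (cxSeries g (i + 1)) + if i + 1 = 1 ∨ i + 1 = r then 2 else 1 :=
    fun i hi => by
      rw [finrank_cxSeries, finrank_cxSeries, finrank_centralSeries_succ, hform.2.2 i hi]
  refine degrees_of_dimensions hr hform.2.1 (fun i j h => Submodule.finrank_mono
    (𝒥.annFiltration_mono h)) ?_ ?_ ?_ ?_ ?_ ?_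
  · have := 𝒥.two_mul_finrank_annFiltration_le hr hqf hform 0
    rw [if_pos (by omega)] at this
    omega
  · rw [hm, 𝒥.type_eq]
  · have := 𝒥.two_mul_finrank_annFiltration_le hr hqf hform 2
    rw [if_pos (by omega)] at this
    omega
  · intro h
    have h1 := hadd 1
    rw [h, zero_add, ← Module.finrank_baseChange (R := ℂ) (S := ℝ)] at h1
    have htop := eq_top_of_sup_cxSeries_one (fun X hX Y hY => 𝒥.lieBr_mem_E hX hY)
      (Submodule.eq_top_of_finrank_eq h1) (cxSeries_nilindex hqf)
    rw [𝒥.type_eq, htop, Submodule.dualAnnihilator_top, finrank_bot]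
  · intro i hi
    have h1 := hadd i
    have h2 := hadd (i + 1)
    have h3 := finrank_sup_add_le 𝒥.E (cxSeries_antitone (g := g) (show i ≤ i + 1 by omega))
    have h4 := hsucc i hi
    omega
  · intro i hi hir heq
    have h1 := hadd i
    have h2 := hadd (i + 1)
    have h3 := hadd (i + 2)
    have hle : ∀ j, 𝒥.E ⊔ cxSeries g (j + 1) ≤ 𝒥.E ⊔ cxSeries g j := fun j =>
      sup_le_sup_left (cxSeries_antitone j.le_succ) _
    -- Equal dimensions of `F_i` and `F_{i+1}` mean that `gⁱ ⊆ E + gⁱ⁺¹`; as `i + 2 ≠ r`, the next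
    -- graded piece is a line and the inclusion propagates.
    have h4 : 𝒥.E ⊔ cxSeries g (i + 1) = 𝒥.E ⊔ cxSeries g i :=
      Submodule.eq_of_le_of_finrank_le (hle i) (by omega)
    have h5 := hsucc (i + 1) hi
    rw [if_neg (by omega)] at h5
    have h6 := cxSeries_succ_le_sup 𝒥.E_sup_conj (fun X hX Y hY => 𝒥.lieBr_mem_E hX hY)
      (h4 ▸ le_sup_right) h5.le
    have h7 : 𝒥.E ⊔ cxSeries g (i + 2) = 𝒥.E ⊔ cxSeries g (i + 1) :=
      le_antisymm (hle (i + 1)) (sup_le le_sup_left h6)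
    rw [h7] at h3
    omega

end GeneralizedComplexStructure
end GenComplex
end

/-! ### The main theorem -/

open GenComplex in
theorem mainTheorem4 {g : Type*} [LieRing g] [LieAlgebra ℝ g] [FiniteDimensional ℝ g]
    (heven : Even (Module.finrank ℝ g)) (hqf : IsQuasiFiliform g)
    (r : ℕ) (hr : 3 ≤ r) (hform : IsOfFormT g r)
    (𝒥 : GeneralizedComplexStructure g) (k : ℕ) (hk : 𝒥.type = k) :
    (∃ θ : Fin k → CxForm g, 𝒥.IsAssociated θ ∧ IsAppropriate θ ∧
      ((∀ j : Fin k, nilDegree (θ j) = firstDegrees r j) ∨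
        (∀ j : Fin k, nilDegree (θ j) = secondDegrees r j))) ∧
    (∀ θ : Fin k → CxForm g, 𝒥.IsAssociated θ →
      (∀ j : Fin k, nilDegree (θ j) = secondDegrees r j) → k < r) := by
  subst hk
  refine ⟨?_, fun θ hθ hdeg => ?_⟩
  · obtain ⟨a, ha, hj⟩ := 𝒥.exists_degrees hr hqf hform
    have hmono : Monotone a := by
      rcases ha with rfl | rfl
      · exact firstDegrees_mono (by omega)
      · exact secondDegrees_mono (by omega)
    have hF := 𝒥.annFiltration_mono
    have hle : ∀ i, Module.finrank ℂ (𝒥.annFiltration i) ≤ 𝒥.type := fun i => by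
      rw [𝒥.type_eq]; exact Submodule.finrank_mono inf_le_left
    obtain ⟨θ, hθ, hmem⟩ := exists_linearIndependent_mem 𝒥.annFiltration a 𝒥.type
      fun j hj' => (hj j hj').1
    have ha' := fun j hj' => (hj j hj').2
    have hspan_le : Submodule.span ℂ (Set.range θ) ≤ 𝒥.E.dualAnnihilator :=
      Submodule.span_le.2 (by rintro _ ⟨j, rfl⟩; exact (hmem j).1)
    have hspan : Submodule.span ℂ (Set.range θ) = 𝒥.E.dualAnnihilator :=
      Submodule.eq_of_le_of_finrank_le hspan_le
        (by rw [finrank_span_eq_card hθ, Fintype.card_fin, 𝒥.type_eq])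
    have hnil : ∀ j : Fin 𝒥.type, nilDegree (θ j) = a j := fun j => by
      refine le_antisymm ((nilDegree_le_iff hqf _ _).2 (hmem j).2) (ha' j j.2 _ ?_)
      exact (mem_iff_of_adapted hF hθ hmem ha' hle _ j).1 ⟨(hmem j).1, mem_V_nilDegree hqf _⟩
    refine ⟨θ, 𝒥.isAssociated_of_span_eq hθ hspan, ⟨fun i j hij => ?_, fun i => ?_⟩, ?_⟩
    · rw [hnil, hnil]; exact hmono hij.le
    · refine linearIndependent_mkQ_of_adapted hF hθ hmem ha' hle i
        (fun w hw hwV => ⟨hspan_le hw, hwV⟩) fun j hij h => ?_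
      exact absurd ((nilDegree_le_iff hqf _ _).2 h.2) (by omega)
    · rcases ha with rfl | rfl
      · exact .inl hnil
      · exact .inr hnil
  · rcases lt_or_ge 𝒥.type 3 with h3 | h3
    · omega
    have : Nontrivial g := Module.nontrivial_of_finrank_pos (R := ℝ) (by have := hqf.2; omega)
    -- The last degree bounds the others, and `k ≥ 3` keeps the index at least `r`. The reality
    -- bound there reads `2k ≤ (r + k - 3) + 2`.
    have hsub : Submodule.span ℂ (Set.range θ) ≤ 𝒥.annFiltration (r + 𝒥.type - 3) := by
      refine Submodule.span_le.2 ?_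
      rintro _ ⟨j, rfl⟩
      refine ⟨hθ.mem_dualAnnihilator j, (nilDegree_le_iff hqf _ _).1 ?_⟩
      rw [hdeg]
      refine (secondDegrees_mono (by omega) (show (j : ℕ) ≤ 𝒥.type - 3 + 2 by omega)).trans ?_
      simp only [secondDegrees]
      omega
    have h1 := Submodule.finrank_mono hsub
    rw [finrank_span_eq_card hθ.linearIndependent, Fintype.card_fin] at h1
    have h2 := 𝒥.two_mul_finrank_annFiltration_le hr hqf hform (r + 𝒥.type - 3)
    split_ifs at h2 <;> omega
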